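/- **Theorem (Strong Approximation for a Generic Series Estimator).** Let $a_n$ be real constants with $a_n\to\infty$ and $K=K_n$ integers with $K_n\to\infty$. For each $n$ let $(V_i,\epsilon_i)_{i\le n}=(V_{n,i},\epsilon_{n,i})_{i\le n}$ be i.i.d. on a probability space $(\Omega^{(n)},P_n)$, where the $\epsilon_i$ are real and $V_i\in\mathcal V$ almost surely. For a sequence of random variables, $X_n=o_p(a_n^{-1})$ means that $P_n(|X_n|>\delta\,|a_n^{-1}|)\to0$ for every $\delta>0$ (outer probability where the event is not measurable). Assume the following. (a) The estimator of the function $\theta=\theta_n$ on $\mathcal V$ is $\widehat\theta(v)=p_n(v)'\widehat\beta$, where $p_n(v)=(p_1(v),\dots,p_K(v))'$ is a vector of (measurable) basis functions and $\widehat\beta$ is a $K$-vector of estimates. (b) $E[\epsilon_i p_n(V_i)]=0$, the matrix $S_n:=E[\epsilon_i^2p_n(V_i)p_n(V_i)']$ is invertible, the eigenvalues of $S_n^{-1}$ are bounded above by $s_n$, $Q_n$ is a non-random invertible $K\times K$ matrix (not necessarily symmetric), $\Omega_n:=Q_n^{-1}S_n(Q_n^{-1})'$, and for some non-random $K$-vector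 $\beta=\beta_n$, $$\Omega_n^{-1/2}\sqrt n(\widehat\beta-\beta)=n^{-1/2}\,\Omega_n^{-1/2}Q_n^{-1}\sum_{i=1}^n p_n(V_i)\epsilon_i+r_n,\qquad \|r_n\|=o_p(a_n^{-1}),$$ where $\Omega_n^{1/2}$ is the positive definite square root of $\Omega_n$ and $\Omega_n^{-1/2}$ is its inverse. (c) $\theta(v)=p_n(v)'\beta+A_n(v)$ for $v\in\mathcal V$, where, with $g_n(v)':=p_n(v)'\Omega_n^{1/2}$, $$\sup_{v\in\mathcal V}\sqrt n\,|A_n(v)|/\|g_n(v)\|=o(a_n^{-1}).$$ (d) $E|\epsilon_i|^3$ and $\sup_{v\in\mathcal V}\max_j|p_j(v)|$ are finite and bounded uniformly in $n$, and $a_n^6s_n^3K^5/n\to0$. Then, after each probability space $(\Omega^{(n)},P_n)$ has been enlarged by an independent random variable uniformly distributed on $[0,1]$, that is, on $(\Omega^{(n)}\times[0,1],\,P_n\otimes\mathrm{Leb})$, there are random vectors $\mathcal N_n$ with distribution $N(0,I_K)$ such that $$\big\|\Omega_n^{-1/2}\sqrt n(\widehat\beta-\beta)-\mathcal N_n\big\|=o_p(a_n^{-1}),$$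 and, as a consequence, for the same vectors $\mathcal N_n$, $$\sup_{v\in\mathcal V}\left|\frac{\sqrt n(\widehat\theta(v)-\theta(v))}{\|g_n(v)\|}-\frac{g_n(v)'}{\|g_n(v)\|}\mathcal N_n\right|=o_p(a_n^{-1}).$$ Here a quotient with denominator $\|g_n(v)\|=0$ is read as $0$. -/

import Mathlib

open MeasureTheory ProbabilityTheory Filter Topology
open scoped ENNReal MatrixOrder

namespace SeriesApprox

/-- The Euclidean space `ℝᵏ`. -/
abbrev Vec (k : ℕ) : Type := EuclideanSpace ℝ (Fin k)

/-- The matrix-vector product `M x`, as a vector of the Euclidean space `ℝᵏ`. -/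
noncomputable def mulVecE {k : ℕ} (M : Matrix (Fin k) (Fin k) ℝ) (x : Vec k) : Vec k :=
  WithLp.toLp 2 (Matrix.mulVec M (WithLp.ofLp x))

/-- The transpose of the row vector `x' M`, as a vector of the Euclidean space `ℝᵏ`. -/
noncomputable def vecMulE {k : ℕ} (x : Vec k) (M : Matrix (Fin k) (Fin k) ℝ) : Vec k :=
  WithLp.toLp 2 (Matrix.vecMul (WithLp.ofLp x) M)

/-- The matrix `E[ε² p(V) p(V)']`. -/
noncomputable def scoreCov {Ω X : Type*} [MeasurableSpace Ω] {k : ℕ} (P : Measure Ω)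
    (p : X → Vec k) (V : Ω → X) (ε : Ω → ℝ) : Matrix (Fin k) (Fin k) ℝ :=
  Matrix.of fun j l => ∫ ω, ε ω ^ 2 * p (V ω) j * p (V ω) l ∂P

/-- The matrix `Q⁻¹ S (Q⁻¹)'`. -/
noncomputable def sandwich {k : ℕ} (Q S : Matrix (Fin k) (Fin k) ℝ) : Matrix (Fin k) (Fin k) ℝ :=
  Q⁻¹ * S * (Q⁻¹).transpose

/-- The positive semidefinite square root `M^{1/2}` of a positive semidefinite matrix `M`. -/
noncomputable def rootM {k : ℕ} (M : Matrix (Fin k) (Fin k) ℝ) : Matrix (Fin k) (Fin k) ℝ :=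
  CFC.sqrt M

/-- The matrix `M^{-1/2}` of a positive definite matrix `M`. -/
noncomputable def invRootM {k : ℕ} (M : Matrix (Fin k) (Fin k) ℝ) : Matrix (Fin k) (Fin k) ℝ :=
  (rootM M)⁻¹

/-- `rootM M` is the unique positive semidefinite matrix with square `M`. -/
theorem rootM_eq_iff {k : ℕ} {M R : Matrix (Fin k) (Fin k) ℝ} (hM : M.PosSemidef) :
    rootM M = R ↔ R.PosSemidef ∧ R * R = M := by
  constructor
  · rintro rfl
    exact ⟨Matrix.nonneg_iff_posSemidef.mp (CFC.sqrt_nonneg M), CFC.sqrt_mul_sqrt_self M hM.nonneg⟩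
  · rintro ⟨hR, h⟩
    exact CFC.sqrt_unique h hR.nonneg

/-- The supremum `sup_{v ∈ 𝒱} |f v|`, as an extended nonnegative number. -/
noncomputable def supOn {X : Type*} (𝒱 : Set X) (f : X → ℝ) : ℝ≥0∞ := ⨆ v ∈ 𝒱, ‖f v‖ₑ

/-- `x_n = o(r_n)` for a deterministic sequence `x_n ∈ [0, ∞]`. -/
def LittleO (x : ℕ → ℝ≥0∞) (r : ℕ → ℝ) : Prop :=
  ∀ δ : ℝ, 0 < δ → ∀ᶠ n in atTop, x n ≤ ENNReal.ofReal (δ * |r n|)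

/-- `X_n = o_p(r_n)` for functions `X_n : Ω_n → [0, ∞]` on probability spaces `(Ω_n, P_n)`:
`P_n(X_n > δ |r_n|) → 0` for every `δ > 0`. Where the event is not measurable, `P_n` is the outer
probability. -/
def LittleOP {Ω : ℕ → Type*} [∀ n, MeasurableSpace (Ω n)] (P : ∀ n, Measure (Ω n))
    (X : ∀ n, Ω n → ℝ≥0∞) (r : ℕ → ℝ) : Prop :=
  ∀ δ : ℝ, 0 < δ →
    Tendsto (fun n => P n {ω | ENNReal.ofReal (δ * |r n|) < X n ω}) atTop (𝓝 0)

end SeriesApprox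

/-!
The standardized estimator differs from the sum `∑ ξᵢ`, where `ξᵢ = n^{-1/2} W^{-1/2} Q⁻¹ p(Vᵢ)
εᵢ`, by the remainder `r`. The `ξᵢ` are independent and centered with covariance `I / n`
(`whitening_mul_mul_transpose`), and `E ‖ξᵢ‖³` is at most of order `(s K / n)^{3/2}`, because
`W^{-1/2} Q⁻¹` maps `x` to a vector of squared length `x' S⁻¹ x`. The theorem therefore follows
from Yurinskii's coupling of `∑ ξᵢ` with a standard Gaussian vector, at a scale slightly smaller
than `1 / a` (`exists_yurinskii_coupling`, `exists_score_coupling`). The statement on the supremum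
is deterministic given the first one: `g(v)'/‖g(v)‖` has norm at most one
(`enorm_studentized_sub_le`).

Yurinskii's coupling has two halves.

* Smoothing. For every set `A`, the probability that `∑ ξᵢ` lies in `A` exceeds the Gaussian measure
  of the `3δ`-neighborhood of `A` by at most `2/t + C t k n E‖ξ‖³ / δ³` (`yurinskii_inequality`).
  The indicator of `A` is replaced by a Lipschitz function `g` with constant `1 / δ`, and `g` by its
  convolution with a Gaussian of covariance `τ I`, where `τ = δ² / (t k)`; Markov's inequality for
  `‖Z‖²` controls the effect of the convolution. The convolution has a second-order Taylor expansion
  with remainder at most `2 ‖h‖³ / (δ τ)`, free of the dimension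
  (`abs_integral_add_stdGaussian_taylor_le`, a consequence of the Cameron–Martin formula
  `map_add_stdGaussian`). Lindeberg's replacement of the `ξᵢ` by Gaussian vectors of the same
  covariance then costs `n` such remainders (`abs_integral_gaussSmooth_sum_sub_le`).

* Coupling. Such a comparison of two laws yields a coupling under which the two vectors are farther
  apart than `3δ` only with the stated probability: Strassen's theorem
  (`exists_coupling_of_le_thickening`), reduced by a partition into small cells to a weighted
  marriage theorem for finite sets (`exists_subCoupling_of_hall`). Disintegration of the coupling
  realizes it as a function of the sample and an independent uniform variable
  (`exists_realization_of_coupling`).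

The growth condition gives `k n E‖ξ‖³ a³ → 0`, so that `δ a`, `1 / t` and the error can tend to zero
together (`tendsto_yurinskii_rate`, `exists_pos_null_pow_eight`).
-/

namespace SeriesApprox

/-! ### Transporting finite weights along a relation -/

/-- The sub-couplings of the weights `μ` and `ν` carried by the relation `R`. -/
def subCouplings {I J : Type*} [Fintype I] [Fintype J] (R : I → J → Prop) (μ : I → ℝ) (ν : J → ℝ) :
    Set (I → J → ℝ) :=
  {π | (∀ i j, 0 ≤ π i j) ∧ (∀ i j, ¬ R i j → π i j = 0) ∧ (∀ i, ∑ j, π i j ≤ μ i) ∧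
    ∀ j, ∑ i, π i j ≤ ν j}

lemma isCompact_subCouplings {I J : Type*} [Fintype I] [Fintype J] (R : I → J → Prop)
    (μ : I → ℝ) (ν : J → ℝ) : IsCompact (subCouplings R μ ν) := by
  have hsub : subCouplings R μ ν ⊆ Set.Icc (fun _ _ => 0) (fun i _ => μ i) := by
    rintro π ⟨h0, -, h1, -⟩
    refine ⟨fun i j => h0 i j, fun i j => le_trans ?_ (h1 i)⟩
    exact Finset.single_le_sum (f := fun j => π i j) (fun j _ => h0 i j) (Finset.mem_univ j)
  refine isCompact_Icc.of_isClosed_subset ?_ hsub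
  simp only [subCouplings, Set.ofPred_and, Set.ofPred_forall]
  refine .inter ?_ (.inter ?_ (.inter ?_ ?_))
  · exact isClosed_iInter fun i => isClosed_iInter fun j => isClosed_le (by fun_prop) (by fun_prop)
  · exact isClosed_iInter fun i => isClosed_iInter fun j => isClosed_iInter fun _ =>
      isClosed_eq (by fun_prop) (by fun_prop)
  · exact isClosed_iInter fun i => isClosed_le (by fun_prop) (by fun_prop)
  · exact isClosed_iInter fun i => isClosed_le (by fun_prop) (by fun_prop)

/-- The weighted form of Hall's marriage theorem. Among the sub-couplings of maximal total mass,
one is chosen whose set `A` of unsaturated rows is as large as possible. Every column related to `A`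
is then saturated (else mass could be added) by rows of `A` only (else mass could be moved to
enlarge `A`), which turns Hall's condition for `A` into the lower bound for the total mass. -/
theorem exists_subCoupling_of_hall {I J : Type*} [Fintype I] [Fintype J] (R : I → J → Prop)
    (μ : I → ℝ) (ν : J → ℝ) (hμ : ∀ i, 0 ≤ μ i) (hν : ∀ j, 0 ≤ ν j) (e : ℝ)
    (h : ∀ (A : Finset I) (B : Finset J), (∀ i ∈ A, ∀ j, R i j → j ∈ B) →
      ∑ i ∈ A, μ i ≤ ∑ j ∈ B, ν j + e) :
    ∃ π ∈ subCouplings R μ ν, ∑ i, μ i - e ≤ ∑ i, ∑ j, π i j := by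
  classical
  have hne : (subCouplings R μ ν).Nonempty :=
    ⟨fun _ _ => 0, by simp, by simp, by simpa using hμ, by simpa using hν⟩
  obtain ⟨π₀, hπ₀, hmax₀⟩ := (isCompact_subCouplings R μ ν).exists_isMaxOn hne
    (f := fun π => ∑ i, ∑ j, π i j) (by fun_prop)
  set M : Set (I → J → ℝ) :=
    {π | π ∈ subCouplings R μ ν ∧ ∑ i, ∑ j, π₀ i j ≤ ∑ i, ∑ j, π i j} with hM
  let slack : (I → J → ℝ) → Finset I := fun π => Finset.univ.filter fun i => ∑ j, π i j < μ i
  obtain ⟨π, hπM, hπmin⟩ : ∃ π ∈ M, ∀ π' ∈ M, (slack π').card ≤ (slack π).card := by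
    have hMne : M.Nonempty := ⟨π₀, hπ₀, le_rfl⟩
    have hle : ∀ π, (slack π).card ≤ Fintype.card I := fun π => Finset.card_le_univ _
    refine ⟨Function.argminOn (fun π => Fintype.card I - (slack π).card) M hMne,
      Function.argminOn_mem _ _ _, fun π' hπ' => ?_⟩
    have := Function.argminOn_le (fun π => Fintype.card I - (slack π).card) M hπ'
    have h1 := hle π'
    have h2 := hle (Function.argminOn (fun π => Fintype.card I - (slack π).card) M hMne)
    omega
  obtain ⟨⟨h0, hR, hrow, hcol⟩, htot⟩ := hπM
  have hmaxπ : ∀ π' ∈ subCouplings R μ ν, ∑ i, ∑ j, π' i j ≤ ∑ i, ∑ j, π i j :=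
    fun π' hπ' => (hmax₀ hπ').trans htot
  set A := slack π with hA
  set B : Finset J := Finset.univ.filter fun j => ∃ i ∈ A, R i j with hB
  have hsat : ∀ j ∈ B, ∑ i, π i j = ν j := by
    intro j hj
    obtain ⟨i, hiA, hij⟩ : ∃ i ∈ A, R i j := by simpa [hB] using hj
    have hi : ∑ j, π i j < μ i := by simpa [hA, slack] using hiA
    by_contra hne
    have hlt : ∑ i, π i j < ν j := lt_of_le_of_ne (hcol j) hne
    obtain ⟨t, ht0, ht1, ht2⟩ : ∃ t, 0 < t ∧ ∑ j, π i j + t ≤ μ i ∧ ∑ i, π i j + t ≤ ν j := by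
      refine ⟨min (μ i - ∑ j, π i j) (ν j - ∑ i, π i j), lt_min (by linarith) (by linarith), ?_, ?_⟩
      · linarith [min_le_left (μ i - ∑ j, π i j) (ν j - ∑ i, π i j)]
      · linarith [min_le_right (μ i - ∑ j, π i j) (ν j - ∑ i, π i j)]
    let π' : I → J → ℝ := fun a b => π a b + if a = i then (if b = j then t else 0) else 0
    have hr' : ∀ a, ∑ b, π' a b = ∑ b, π a b + if a = i then t else 0 := by
      intro a
      by_cases ha : a = i <;> simp [π', ha, Finset.sum_add_distrib]
    have hc' : ∀ b, ∑ a, π' a b = ∑ a, π a b + if b = j then t else 0 := by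
      intro b
      simp [π', Finset.sum_add_distrib]
    have hmem : π' ∈ subCouplings R μ ν := by
      refine ⟨fun a b => ?_, fun a b hab => ?_, fun a => ?_, fun b => ?_⟩
      · have := h0 a b
        simp only [π']
        split_ifs <;> linarith
      · have : ¬ (a = i ∧ b = j) := by rintro ⟨rfl, rfl⟩; exact hab hij
        simp only [π', hR a b hab]
        split_ifs <;> simp_all
      · rw [hr']
        split_ifs with ha
        · rw [ha]; exact ht1
        · simpa using hrow a
      · rw [hc']
        split_ifs with ha
        · rw [ha]; exact ht2
        · simpa using hcol b
    have := hmaxπ π' hmem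
    simp only [hr', Finset.sum_add_distrib, Finset.sum_ite_eq', Finset.mem_univ, if_true] at this
    linarith
  have hclosed : ∀ j ∈ B, ∀ i', i' ∉ A → π i' j = 0 := by
    intro j hj i' hi'
    obtain ⟨i, hiA, hij⟩ : ∃ i ∈ A, R i j := by simpa [hB] using hj
    have hi : ∑ j, π i j < μ i := by simpa [hA, slack] using hiA
    have hne : i ≠ i' := by rintro rfl; exact hi' hiA
    have hi'row : ∑ j, π i' j = μ i' := by
      refine le_antisymm (hrow i') ?_
      simpa [hA, slack] using hi'
    by_contra hpos
    have hpos : 0 < π i' j := lt_of_le_of_ne (h0 i' j) (Ne.symm hpos)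
    obtain ⟨t, ht0, ht1, ht2⟩ : ∃ t, 0 < t ∧ ∑ j, π i j + t < μ i ∧ t ≤ π i' j := by
      refine ⟨min ((μ i - ∑ j, π i j) / 2) (π i' j), lt_min (by linarith) hpos, ?_,
        min_le_right _ _⟩
      linarith [min_le_left ((μ i - ∑ j, π i j) / 2) (π i' j)]
    let π' : I → J → ℝ := fun a b => π a b +
      ((if a = i then (if b = j then t else 0) else 0) -
        (if a = i' then (if b = j then t else 0) else 0))
    have hr' : ∀ a, ∑ b, π' a b = ∑ b, π a b + ((if a = i then t else 0) -
        (if a = i' then t else 0)) := by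
      intro a
      by_cases ha : a = i <;> by_cases ha' : a = i' <;>
        simp [π', ha, ha', Finset.sum_add_distrib, Finset.sum_sub_distrib]
    have hc' : ∀ b, ∑ a, π' a b = ∑ a, π a b := by
      intro b
      simp [π', Finset.sum_add_distrib, Finset.sum_sub_distrib]
    have hmem : π' ∈ subCouplings R μ ν := by
      refine ⟨fun a b => ?_, fun a b hab => ?_, fun a => ?_, fun b => ?_⟩
      · have := h0 a b
        simp only [π']
        by_cases ha' : a = i'
        · subst ha'
          by_cases hb : b = j
          · subst hb
            simp [hne.symm]; linarith
          · simp [hb, this]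
        · simp only [ha', if_false, sub_zero]
          split_ifs <;> linarith
      · have h1 : ¬ (a = i ∧ b = j) := by rintro ⟨rfl, rfl⟩; exact hab hij
        have h2 : ¬ (a = i' ∧ b = j) := by
          rintro ⟨rfl, rfl⟩
          exact hpos.ne' (hR _ _ hab)
        simp only [π', hR a b hab]
        split_ifs <;> simp_all
      · rw [hr']
        by_cases ha : a = i
        · subst ha; simp [hne]; linarith
        · have := hrow a
          simp only [ha, if_false]
          split_ifs <;> linarith
      · rw [hc']; exact hcol b
    have hM' : π' ∈ M := by
      refine ⟨hmem, htot.trans (le_of_eq ?_)⟩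
      simp [hr', Finset.sum_add_distrib, Finset.sum_sub_distrib]
    have hcard := hπmin π' hM'
    have hsub : insert i' A ⊆ slack π' := by
      intro a ha
      simp only [slack, Finset.mem_filter, Finset.mem_univ, true_and, hr']
      rcases Finset.mem_insert.1 ha with rfl | haA'
      · simp [hne.symm, hi'row, ht0]
      · have hai' : a ≠ i' := by rintro rfl; exact hi' haA'
        have haA : ∑ j, π a j < μ a := by simpa [hA, slack] using haA'
        by_cases hai : a = i
        · subst hai; simpa [hai'] using ht1
        · simpa [hai, hai'] using haA
    have := Finset.card_le_card hsub
    rw [Finset.card_insert_of_notMem hi'] at this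
    omega
  refine ⟨π, ⟨h0, hR, hrow, hcol⟩, ?_⟩
  have key : ∑ j ∈ B, ν j = ∑ i ∈ A, ∑ j, π i j := by
    calc ∑ j ∈ B, ν j = ∑ j ∈ B, ∑ i, π i j := Finset.sum_congr rfl fun j hj => (hsat j hj).symm
      _ = ∑ j ∈ B, ∑ i ∈ A, π i j := Finset.sum_congr rfl fun j hj =>
          (Finset.sum_subset (Finset.subset_univ A) fun i _ hi => hclosed j hj i hi).symm
      _ = ∑ i ∈ A, ∑ j ∈ B, π i j := Finset.sum_comm
      _ = ∑ i ∈ A, ∑ j, π i j := Finset.sum_congr rfl fun i hi => by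
          refine Finset.sum_subset (Finset.subset_univ B) fun j _ hj => hR i j fun hij => hj ?_
          simpa [hB] using ⟨i, hi, hij⟩
  have hHall := h A B fun i hi j hij => by simpa [hB] using ⟨i, hi, hij⟩
  rw [key] at hHall
  have hout : ∑ i ∈ Finset.univ \ A, μ i = ∑ i ∈ Finset.univ \ A, ∑ j, π i j := by
    refine Finset.sum_congr rfl fun i hi => le_antisymm ?_ (hrow i)
    simpa [hA, slack] using hi
  have e1 := Finset.sum_sdiff (Finset.subset_univ A) (f := μ)
  have e2 := Finset.sum_sdiff (Finset.subset_univ A) (f := fun i => ∑ j, π i j)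
  linarith

/-- Two weights of mass `1` have a coupling which gives mass at least `1 - e` to the relation `R`
as soon as Hall's condition holds up to `e`. -/
theorem exists_coupling_of_hall {I J : Type*} [Fintype I] [Fintype J] (R : I → J → Prop)
    (μ : I → ℝ) (ν : J → ℝ) (hμ : ∀ i, 0 ≤ μ i) (hν : ∀ j, 0 ≤ ν j)
    (hμ1 : ∑ i, μ i = 1) (hν1 : ∑ j, ν j = 1) (e : ℝ)
    (h : ∀ (A : Finset I) (B : Finset J), (∀ i ∈ A, ∀ j, R i j → j ∈ B) →
      ∑ i ∈ A, μ i ≤ ∑ j ∈ B, ν j + e) :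
    ∃ π ρ : I → J → ℝ, (∀ i j, 0 ≤ π i j) ∧ (∀ i j, 0 ≤ ρ i j) ∧ (∀ i j, ¬ R i j → π i j = 0) ∧
      (∀ i, ∑ j, (π i j + ρ i j) = μ i) ∧ (∀ j, ∑ i, (π i j + ρ i j) = ν j) ∧
      ∑ i, ∑ j, ρ i j ≤ e := by
  obtain ⟨π, ⟨h0, hR, hrow, hcol⟩, htot⟩ := exists_subCoupling_of_hall R μ ν hμ hν e h
  -- The mass `m` that `π` leaves over is coupled independently.
  set m : ℝ := 1 - ∑ i, ∑ j, π i j with hm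
  have hra : ∑ i, (μ i - ∑ j, π i j) = m := by rw [Finset.sum_sub_distrib, hμ1]
  have hcb : ∑ j, (ν j - ∑ i, π i j) = m := by
    rw [Finset.sum_sub_distrib, hν1, Finset.sum_comm]
  have hra0 : ∀ i, 0 ≤ μ i - ∑ j, π i j := fun i => sub_nonneg.2 (hrow i)
  have hcb0 : ∀ j, 0 ≤ ν j - ∑ i, π i j := fun j => sub_nonneg.2 (hcol j)
  have hm0 : 0 ≤ m := hra ▸ Finset.sum_nonneg fun i _ => hra0 i
  have hmr : ∀ i, (μ i - ∑ j, π i j) * m / m = μ i - ∑ j, π i j := by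
    intro i
    by_cases hmz : m = 0
    · have := (Finset.sum_eq_zero_iff_of_nonneg fun i _ => hra0 i).1 (hra.trans hmz) i
        (Finset.mem_univ i)
      simp [this]
    · field_simp
  have hmc : ∀ j, m * (ν j - ∑ i, π i j) / m = ν j - ∑ i, π i j := by
    intro j
    by_cases hmz : m = 0
    · have := (Finset.sum_eq_zero_iff_of_nonneg fun i _ => hcb0 i).1 (hcb.trans hmz) j
        (Finset.mem_univ j)
      simp [this]
    · field_simp
  have hrowρ : ∀ i, ∑ j, (μ i - ∑ j, π i j) * (ν j - ∑ i, π i j) / m = μ i - ∑ j, π i j := by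
    intro i
    rw [← Finset.sum_div, ← Finset.mul_sum, hcb, hmr]
  refine ⟨π, fun i j => (μ i - ∑ j, π i j) * (ν j - ∑ i, π i j) / m, h0,
    fun i j => div_nonneg (mul_nonneg (hra0 i) (hcb0 j)) hm0, hR, fun i => ?_, fun j => ?_, ?_⟩
  · rw [Finset.sum_add_distrib, hrowρ]; ring
  · rw [Finset.sum_add_distrib, ← Finset.sum_div, ← Finset.sum_mul, hra, hmc]; ring
  · simp only [hrowρ, hra]
    linarith

/-! ### Couplings of probability measures -/

lemma exists_measurable_nat_dist_le {E : Type*} [PseudoMetricSpace E]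
    [TopologicalSpace.SeparableSpace E] [MeasurableSpace E] [OpensMeasurableSpace E] {η : ℝ}
    (hη : 0 < η) : ∃ idx : E → ℕ, Measurable idx ∧ ∀ x y, idx x = idx y → dist x y ≤ η := by
  obtain ⟨As, hm, hb, hd, hu, hdisj⟩ := SeparableSpace.exists_measurable_partition_diam_le E hη
  have hex : ∀ x, ∃ n, x ∈ As n := fun x => by
    have : x ∈ ⋃ n, As n := hu ▸ Set.mem_univ x
    simpa using this
  choose idx hidx using hex
  refine ⟨idx, measurable_to_countable' fun n => ?_, fun x y hxy => ?_⟩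
  · convert hm n
    ext x
    simp only [Set.mem_preimage, Set.mem_singleton_iff]
    refine ⟨fun h => h ▸ hidx x, fun h => ?_⟩
    by_contra hne
    exact Set.disjoint_left.1 (hdisj hne) (hidx x) h
  · exact (Metric.dist_le_diam_of_mem (hb _) (hidx x) (hxy ▸ hidx y)).trans (hd _)

/-- A measurable map into a finite type whose fibers have diameter at most `η`, apart from one
exceptional fiber of small mass for both measures. -/
lemma exists_quantization {E : Type*} [PseudoMetricSpace E] [TopologicalSpace.SeparableSpace E]
    [MeasurableSpace E] [OpensMeasurableSpace E] (μ ν : Measure E) [IsProbabilityMeasure μ]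
    [IsProbabilityMeasure ν] {η : ℝ} (hη : 0 < η) :
    ∃ (N : ℕ) (c : E → Fin (N + 1)), Measurable c ∧
      (∀ x y, c x = c y → c x ≠ Fin.last N → dist x y ≤ η) ∧
      μ.real (c ⁻¹' {Fin.last N}) ≤ η ∧ ν.real (c ⁻¹' {Fin.last N}) ≤ η := by
  obtain ⟨idx, hidx, hdist⟩ := exists_measurable_nat_dist_le (E := E) hη
  have htail : ∀ (m : Measure E) [IsProbabilityMeasure m],
      ∀ᶠ N in atTop, m.real {x | N ≤ idx x} ≤ η := by
    intro m _
    have h := tendsto_measure_iInter_atTop (μ := m) (s := fun N : ℕ => {x | N ≤ idx x})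
      (fun N => (measurableSet_le measurable_const hidx).nullMeasurableSet)
      (fun N M hNM x hx => le_trans hNM hx) ⟨0, by simp⟩
    have hemp : ⋂ N : ℕ, {x | N ≤ idx x} = ∅ := by
      ext x
      simp only [Set.mem_iInter, Set.mem_ofPred_eq, Set.mem_empty_iff_false, iff_false, not_forall,
        not_le]
      exact ⟨idx x + 1, Nat.lt_succ_self _⟩
    rw [hemp, measure_empty] at h
    filter_upwards [h.eventually_le_const (ENNReal.ofReal_pos.2 hη)] with N hN
    exact ENNReal.toReal_le_of_le_ofReal hη.le hN
  obtain ⟨N, hμ, hν⟩ := ((htail μ).and (htail ν)).exists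
  have hpre : (fun x => (⟨min (idx x) N, by omega⟩ : Fin (N + 1))) ⁻¹' {Fin.last N} =
      {x | N ≤ idx x} := by
    ext x
    simp [Fin.ext_iff]
  refine ⟨N, fun x => ⟨min (idx x) N, by omega⟩, ?_, fun x y hxy hx => hdist x y ?_, ?_, ?_⟩
  · have : Measurable fun n : ℕ => (⟨min n N, by omega⟩ : Fin (N + 1)) := measurable_from_top
    exact this.comp hidx
  · simp only [ne_eq, Fin.ext_iff, Fin.val_last] at hxy hx
    omega
  · rwa [hpre]
  · rwa [hpre]

lemma sum_measureReal_fiber {E I : Type*} [MeasurableSpace E] [MeasurableSpace I]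
    [DiscreteMeasurableSpace I] {c : E → I} (hc : Measurable c) (μ : Measure E)
    [IsFiniteMeasure μ] (A : Finset I) :
    ∑ i ∈ A, μ.real (c ⁻¹' {i}) = μ.real (c ⁻¹' A) := by
  rw [← measureReal_biUnion_finset]
  · congr 1
    ext x
    simp
  · intro i _ j _ hij
    exact Disjoint.preimage _ (by simpa using hij)
  · exact fun i _ => hc (MeasurableSet.of_discrete)

/-- The coupling of `μ` and `ν` that is conditionally independent given the cells, and in which the
pair of cells has the weights `w`. -/
noncomputable def cellCoupling {E I : Type*} [MeasurableSpace E] [Fintype I] (c : E → I)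
    (μ ν : Measure E) (w : I → I → ℝ) : Measure (E × E) :=
  ∑ i, ∑ j, ENNReal.ofReal (w i j) • (μ[|c ⁻¹' {i}]).prod (ν[|c ⁻¹' {j}])

lemma fst_cellCoupling {E I : Type*} [MeasurableSpace E] [Fintype I] [MeasurableSpace I]
    [DiscreteMeasurableSpace I] {c : E → I} (hc : Measurable c) (μ ν : Measure E)
    [IsFiniteMeasure μ] [IsFiniteMeasure ν] {w : I → I → ℝ}
    (hw : ∀ i j, 0 ≤ w i j) (hrow : ∀ i, ∑ j, w i j = μ.real (c ⁻¹' {i}))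
    (hcol : ∀ j, ∑ i, w i j = ν.real (c ⁻¹' {j})) :
    (cellCoupling c μ ν w).map Prod.fst = μ := by
  have hterm : ∀ i j, (ENNReal.ofReal (w i j) • (μ[|c ⁻¹' {i}]).prod (ν[|c ⁻¹' {j}])).map Prod.fst =
      ENNReal.ofReal (w i j) • μ[|c ⁻¹' {i}] := by
    intro i j
    rw [Measure.map_smul]
    by_cases hj : ν (c ⁻¹' {j}) = 0
    · have h0 : ∑ i, w i j = 0 := by rw [hcol, measureReal_def, hj, ENNReal.toReal_zero]
      have := (Finset.sum_eq_zero_iff_of_nonneg fun i _ => hw i j).1 h0 i (Finset.mem_univ i)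
      simp [this]
    · have := cond_isProbabilityMeasure hj
      rw [Measure.map_fst_prod]
      simp
  have hsum : (cellCoupling c μ ν w).map Prod.fst =
      ∑ i, ∑ j, ENNReal.ofReal (w i j) • μ[|c ⁻¹' {i}] := by
    rw [cellCoupling, Measure.map_finset_sum (by fun_prop)]
    refine Finset.sum_congr rfl fun i _ => ?_
    rw [Measure.map_finset_sum (by fun_prop)]
    exact Finset.sum_congr rfl fun j _ => hterm i j
  rw [hsum]
  conv_rhs => rw [← sum_meas_smul_cond_fiber hc μ]
  refine Finset.sum_congr rfl fun i _ => ?_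
  rw [← Finset.sum_smul, ← ENNReal.ofReal_sum_of_nonneg fun j _ => hw i j, hrow, ofReal_measureReal]

lemma map_swap_cellCoupling {E I : Type*} [MeasurableSpace E] [Fintype I] (c : E → I)
    (μ ν : Measure E) [IsFiniteMeasure μ] [IsFiniteMeasure ν] (w : I → I → ℝ) :
    (cellCoupling c μ ν w).map Prod.swap = cellCoupling c ν μ fun i j => w j i := by
  rw [cellCoupling, cellCoupling, Measure.map_finset_sum (by fun_prop)]
  conv_rhs => rw [Finset.sum_comm]
  refine Finset.sum_congr rfl fun i _ => ?_
  rw [Measure.map_finset_sum (by fun_prop)]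
  refine Finset.sum_congr rfl fun j _ => ?_
  rw [Measure.map_smul, Measure.prod_swap]

lemma snd_cellCoupling {E I : Type*} [MeasurableSpace E] [Fintype I] [MeasurableSpace I]
    [DiscreteMeasurableSpace I] {c : E → I} (hc : Measurable c) (μ ν : Measure E)
    [IsFiniteMeasure μ] [IsFiniteMeasure ν] {w : I → I → ℝ}
    (hw : ∀ i j, 0 ≤ w i j) (hrow : ∀ i, ∑ j, w i j = μ.real (c ⁻¹' {i}))
    (hcol : ∀ j, ∑ i, w i j = ν.real (c ⁻¹' {j})) :
    (cellCoupling c μ ν w).map Prod.snd = ν := by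
  have h := fst_cellCoupling hc ν μ (w := fun i j => w j i) (fun i j => hw j i) hcol hrow
  rw [← map_swap_cellCoupling, Measure.map_map (by fun_prop) (by fun_prop)] at h
  exact h

/-- A form of Strassen's theorem. The space is cut into finitely many cells of small diameter, up to
a set of small mass; the hypothesis is Hall's condition for the weights of the cells, and the
resulting coupling of the weights is spread out over the cells. -/
theorem exists_coupling_of_le_thickening {E : Type*} [PseudoMetricSpace E]
    [SecondCountableTopology E] [MeasurableSpace E] [BorelSpace E]
    (μ ν : Measure E) [IsProbabilityMeasure μ] [IsProbabilityMeasure ν] {ρ e : ℝ}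
    (h : ∀ A : Set E, MeasurableSet A → A.Nonempty →
      μ.real A ≤ ν.real (Metric.thickening ρ A) + e) (he : 0 ≤ e) {η : ℝ} (hη : 0 < η) :
    ∃ π : Measure (E × E), π.map Prod.fst = μ ∧ π.map Prod.snd = ν ∧
      π {z | ρ + η ≤ dist z.1 z.2} ≤ ENNReal.ofReal (e + η) := by
  have hη4 : 0 < η / 4 := by positivity
  obtain ⟨N, c, hc, hdist, hμN, hνN⟩ := exists_quantization μ ν hη4
  let R : Fin (N + 1) → Fin (N + 1) → Prop := fun i j =>
    i ≠ Fin.last N ∧ j ≠ Fin.last N ∧ ∃ x y, c x = i ∧ c y = j ∧ dist x y < ρ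
  have hpre : ∀ A : Set (Fin (N + 1)), MeasurableSet (c ⁻¹' A) := fun A => hc .of_discrete
  have hμ1 : ∑ i, μ.real (c ⁻¹' {i}) = 1 := by
    rw [sum_measureReal_fiber hc]; simp
  have hν1 : ∑ i, ν.real (c ⁻¹' {i}) = 1 := by
    rw [sum_measureReal_fiber hc]; simp
  obtain ⟨p, q, hp0, hq0, hpR, hrow, hcol, hq⟩ := exists_coupling_of_hall R
    (fun i => μ.real (c ⁻¹' {i})) (fun j => ν.real (c ⁻¹' {j})) (fun _ => measureReal_nonneg)
    (fun _ => measureReal_nonneg) hμ1 hν1 (e + η / 4 + η / 4) (by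
      intro A B hAB
      rw [sum_measureReal_fiber hc, sum_measureReal_fiber hc]
      set A' : Set E := c ⁻¹' (A \ {Fin.last N}) with hA'
      have h1 : μ.real (c ⁻¹' A) ≤ μ.real A' + η / 4 := by
        refine (measureReal_mono (s₂ := A' ∪ c ⁻¹' {Fin.last N}) ?_).trans
          ((measureReal_union_le _ _).trans (by linarith))
        intro x hx
        by_cases hxl : c x = Fin.last N
        · exact Or.inr hxl
        · exact Or.inl ⟨hx, hxl⟩
      have h2 : ν.real (Metric.thickening ρ A') ≤ ν.real (c ⁻¹' B) + η / 4 := by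
        refine (measureReal_mono (s₂ := c ⁻¹' B ∪ c ⁻¹' {Fin.last N}) ?_).trans
          ((measureReal_union_le _ _).trans (by linarith))
        intro y hy
        obtain ⟨x, hx, hxy⟩ := Metric.mem_thickening_iff.1 hy
        by_cases hyl : c y = Fin.last N
        · exact Or.inr hyl
        · exact Or.inl (hAB (c x) hx.1 (c y) ⟨hx.2, hyl, x, y, rfl, rfl, by rwa [dist_comm]⟩)
      rcases A'.eq_empty_or_nonempty with hemp | hne
      · rw [hemp, measureReal_empty] at h1
        have : 0 ≤ ν.real (c ⁻¹' B) := measureReal_nonneg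
        linarith
      · have h3 := h A' (hpre _) hne
        linarith)
  refine ⟨cellCoupling c μ ν fun i j => p i j + q i j,
    fst_cellCoupling hc μ ν (fun i j => add_nonneg (hp0 i j) (hq0 i j)) hrow hcol,
    snd_cellCoupling hc μ ν (fun i j => add_nonneg (hp0 i j) (hq0 i j)) hrow hcol, ?_⟩
  set D : Set (E × E) := {z | ρ + η ≤ dist z.1 z.2} with hD
  have hDm : MeasurableSet D := measurableSet_le measurable_const (by fun_prop)
  have hterm : ∀ i j, (ENNReal.ofReal (p i j + q i j) •
      (μ[|c ⁻¹' {i}]).prod (ν[|c ⁻¹' {j}])) D ≤ ENNReal.ofReal (q i j) := by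
    intro i j
    rw [Measure.smul_apply, smul_eq_mul]
    have hle1 : ((μ[|c ⁻¹' {i}]).prod (ν[|c ⁻¹' {j}])) D ≤ 1 := by
      refine (measure_mono (Set.subset_univ _)).trans ?_
      rw [← Set.univ_prod_univ, Measure.prod_prod]
      exact mul_le_one' prob_le_one prob_le_one
    by_cases hR : R i j
    · -- Related cells: all pairs are closer than `ρ + η`.
      have h0 : ((μ[|c ⁻¹' {i}]).prod (ν[|c ⁻¹' {j}])) D = 0 := by
        have hx : ∀ᵐ x ∂μ[|c ⁻¹' {i}], c x = i := by
          filter_upwards [ae_cond_mem (μ := μ) (hpre {i})] with x hx using hx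
        have hy : ∀ᵐ y ∂ν[|c ⁻¹' {j}], c y = j := by
          filter_upwards [ae_cond_mem (μ := ν) (hpre {j})] with x hx using hx
        rw [Measure.measure_prod_null hDm]
        filter_upwards [hx] with x hx
        refine measure_mono_null (t := {y | c y ≠ j}) (fun y hyD hyj => ?_) hy
        obtain ⟨hi, hj, x', y', hx', hy', hxy⟩ := hR
        have hd1 := hdist x x' (hx.trans hx'.symm) (hx ▸ hi)
        have hd2 := hdist y' y (hy'.trans hyj.symm) (hy' ▸ hj)
        have hd3 : ρ + η ≤ dist x y := hyD
        have := dist_triangle4 x x' y' y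
        linarith
      simp [h0]
    · rw [hpR i j hR, zero_add]
      exact mul_le_of_le_one_right' hle1
  calc cellCoupling c μ ν (fun i j => p i j + q i j) D
      ≤ ∑ i, ∑ j, ENNReal.ofReal (q i j) := by
        simp only [cellCoupling, Measure.finsetSum_apply]
        exact Finset.sum_le_sum fun i _ => Finset.sum_le_sum fun j _ => hterm i j
    _ = ENNReal.ofReal (∑ i, ∑ j, q i j) := by
        rw [ENNReal.ofReal_sum_of_nonneg fun i _ => Finset.sum_nonneg fun j _ => hq0 i j]
        refine Finset.sum_congr rfl fun i _ => ?_
        rw [ENNReal.ofReal_sum_of_nonneg fun j _ => hq0 i j]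
    _ ≤ ENNReal.ofReal (e + η) := ENNReal.ofReal_le_ofReal (by linarith)

/-- A coupling of the law of `S` with another law is realized, with `S` itself as first coordinate,
after an enlargement by an independent uniform variable. -/
theorem exists_realization_of_coupling {Ω E F : Type*} [MeasurableSpace Ω] [MeasurableSpace E]
    [MeasurableSpace F] [StandardBorelSpace F] [Nonempty F] (P : Measure Ω)
    [IsProbabilityMeasure P] {S : Ω → E} (hS : Measurable S) (π : Measure (E × F))
    (hπ : π.map Prod.fst = P.map S) :
    ∃ N : Ω × unitInterval → F, Measurable N ∧
      (P.prod volume).map (fun z => (S z.1, N z)) = π := by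
  have hprob : IsProbabilityMeasure (P.map S) := Measure.isProbabilityMeasure_map hS.aemeasurable
  have hπ1 : IsProbabilityMeasure π := by
    rw [← hπ] at hprob
    exact Measure.isProbabilityMeasure_of_map Prod.fst
  obtain ⟨f, hf, hfκ⟩ := Kernel.exists_measurable_map_eq_unitInterval π.condKernel
  have hfm : ∀ a, Measurable (f a) := fun a => hf.of_uncurry_left
  have hN : Measurable fun z : Ω × unitInterval => f (S z.1) z.2 :=
    hf.comp ((hS.comp measurable_fst).prodMk measurable_snd)
  refine ⟨fun z => f (S z.1) z.2, hN, ?_⟩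
  have hm : Measurable fun z : Ω × unitInterval => (S z.1, f (S z.1) z.2) :=
    (hS.comp measurable_fst).prodMk hN
  ext A hA
  rw [Measure.map_apply hm hA, Measure.prod_apply (hm hA)]
  conv_rhs => rw [← π.disintegrate π.condKernel, Measure.compProd_apply hA, Measure.fst, hπ,
    lintegral_map (Kernel.measurable_kernel_prodMk_left hA) hS]
  refine lintegral_congr fun ω => ?_
  rw [← hfκ, Measure.map_apply (hfm _) (measurable_prodMk_left hA)]
  rfl

/-! ### The standard Gaussian measure -/

lemma map_inner_stdGaussian {E : Type*} [NormedAddCommGroup E] [InnerProductSpace ℝ E]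
    [FiniteDimensional ℝ E] [MeasurableSpace E] [BorelSpace E] (h : E) :
    (stdGaussian E).map (fun z => inner ℝ h z) = gaussianReal 0 (‖h‖ ^ 2).toNNReal := by
  have := IsGaussian.map_eq_gaussianReal (μ := stdGaussian E) (innerSL ℝ h)
  rw [integral_strongDual_stdGaussian, variance_dual_stdGaussian, innerSL_apply_norm] at this
  simpa using this

lemma mgf_inner_stdGaussian {E : Type*} [NormedAddCommGroup E] [InnerProductSpace ℝ E]
    [FiniteDimensional ℝ E] [MeasurableSpace E] [BorelSpace E] (h : E) (t : ℝ) :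
    ∫ z, Real.exp (t * inner ℝ h z) ∂stdGaussian E = Real.exp (‖h‖ ^ 2 * t ^ 2 / 2) := by
  have := mgf_gaussianReal (map_inner_stdGaussian h) t
  simpa [mgf, Real.coe_toNNReal _ (sq_nonneg ‖h‖)] using this

lemma integrable_exp_inner_stdGaussian {E : Type*} [NormedAddCommGroup E] [InnerProductSpace ℝ E]
    [FiniteDimensional ℝ E] [MeasurableSpace E] [BorelSpace E] (h : E) :
    Integrable (fun z => Real.exp (inner ℝ h z)) (stdGaussian E) := by
  have h1 := integrable_exp_mul_gaussianReal (μ := 0) (v := (‖h‖ ^ 2).toNNReal) 1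
  rw [← map_inner_stdGaussian h, integrable_map_measure (by fun_prop) (by fun_prop)] at h1
  simpa [Function.comp_def] using h1

/-- The Cameron–Martin formula, by comparison of the moment generating functions of all linear
forms. -/
theorem map_add_stdGaussian {E : Type*} [NormedAddCommGroup E] [InnerProductSpace ℝ E]
    [FiniteDimensional ℝ E] [MeasurableSpace E] [BorelSpace E] (h : E) :
    (stdGaussian E).map (fun z => z + h) = (stdGaussian E).withDensity
      fun z => ENNReal.ofReal (Real.exp (inner ℝ h z - ‖h‖ ^ 2 / 2)) := by
  set d : E → ℝ := fun z => Real.exp (inner ℝ h z - ‖h‖ ^ 2 / 2) with hd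
  have hdm : Measurable d := by fun_prop
  have hdi : Integrable d (stdGaussian E) := by
    simp only [hd, Real.exp_sub]
    exact (integrable_exp_inner_stdGaussian h).div_const _
  have hd1 : ∫ z, d z ∂stdGaussian E = 1 := by
    have := mgf_inner_stdGaussian h 1
    simp only [one_mul] at this
    simp only [hd, Real.exp_sub]
    rw [integral_div, this]
    simp
  have hp1 : IsProbabilityMeasure ((stdGaussian E).map (fun z => z + h)) :=
    Measure.isProbabilityMeasure_map (by fun_prop)
  have hp2 : IsProbabilityMeasure ((stdGaussian E).withDensity fun z => ENNReal.ofReal (d z)) := by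
    constructor
    rw [withDensity_apply _ .univ, Measure.restrict_univ, ← ofReal_integral_eq_lintegral_ofReal hdi
      (ae_of_all _ fun z => (Real.exp_pos _).le), hd1, ENNReal.ofReal_one]
  refine Measure.ext_of_charFun ?_
  ext t
  have hmgf1 : mgf (fun z => inner ℝ t z) ((stdGaussian E).map (fun z => z + h)) =
      fun s => Real.exp (‖t‖ ^ 2 * s ^ 2 / 2 + s * inner ℝ t h) := by
    ext s
    rw [mgf, integral_map (by fun_prop) (by fun_prop)]
    simp only [inner_add_right, mul_add, Real.exp_add]
    rw [integral_mul_const, mgf_inner_stdGaussian]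
  have hmgf2 : mgf (fun z => inner ℝ t z)
      ((stdGaussian E).withDensity fun z => ENNReal.ofReal (d z)) =
      fun s => Real.exp (‖t‖ ^ 2 * s ^ 2 / 2 + s * inner ℝ t h) := by
    ext s
    rw [mgf, integral_withDensity_eq_integral_toReal_smul (by fun_prop) (by simp)]
    have e1 : ∀ z : E, (ENNReal.ofReal (d z)).toReal • Real.exp (s * inner ℝ t z) =
        Real.exp (1 * inner ℝ (s • t + h) z) * Real.exp (-(‖h‖ ^ 2 / 2)) := by
      intro z
      rw [ENNReal.toReal_ofReal (Real.exp_pos _).le, smul_eq_mul, ← Real.exp_add, ← Real.exp_add,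
        inner_add_left, real_inner_smul_left]
      congr 1; ring
    simp only [e1]
    rw [integral_mul_const, mgf_inner_stdGaussian, ← Real.exp_add]
    congr 1
    rw [norm_add_sq_real, norm_smul, real_inner_smul_left, mul_pow, Real.norm_eq_abs, sq_abs]
    ring
  have hset : integrableExpSet (fun z => inner ℝ t z) ((stdGaussian E).map (fun z => z + h)) =
      Set.univ := by
    ext s
    simp only [integrableExpSet, Set.mem_ofPred_eq, Set.mem_univ, iff_true]
    have : 0 < mgf (fun z => inner ℝ t z) ((stdGaussian E).map (fun z => z + h)) s := by
      rw [hmgf1]; exact Real.exp_pos _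
    exact mgf_pos_iff.1 this
  have := eqOn_complexMGF_of_mgf (hmgf1.trans hmgf2.symm) (x := Complex.I) (by simp [hset])
  simp only [charFun_apply]
  simp only [complexMGF] at this
  simpa [real_inner_comm, mul_comm] using this

theorem integral_add_stdGaussian {E : Type*} [NormedAddCommGroup E] [InnerProductSpace ℝ E]
    [FiniteDimensional ℝ E] [MeasurableSpace E] [BorelSpace E] (h : E) {g : E → ℝ}
    (hg : Measurable g) :
    ∫ z, g (z + h) ∂stdGaussian E =
      ∫ z, Real.exp (inner ℝ h z - ‖h‖ ^ 2 / 2) * g z ∂stdGaussian E := by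
  rw [← integral_map (φ := fun z => z + h) (f := g) (by fun_prop) hg.aestronglyMeasurable,
    map_add_stdGaussian, integral_withDensity_eq_integral_toReal_smul (by fun_prop) (by simp)]
  simp [ENNReal.toReal_ofReal (Real.exp_pos _).le]

lemma integrable_norm_pow_stdGaussian {E : Type*} [NormedAddCommGroup E] [InnerProductSpace ℝ E]
    [FiniteDimensional ℝ E] [MeasurableSpace E] [BorelSpace E] (n : ℕ) :
    Integrable (fun z => ‖z‖ ^ n) (stdGaussian E) :=
  (IsGaussian.memLp_id (stdGaussian E) n (by simp)).integrable_norm_pow'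

lemma integral_inner_stdGaussian {E : Type*} [NormedAddCommGroup E] [InnerProductSpace ℝ E]
    [FiniteDimensional ℝ E] [MeasurableSpace E] [BorelSpace E] (u : E) :
    ∫ z, inner ℝ u z ∂stdGaussian E = 0 := by
  have := integral_strongDual_stdGaussian (innerSL ℝ u)
  simpa using this

lemma integral_inner_sq_stdGaussian {E : Type*} [NormedAddCommGroup E] [InnerProductSpace ℝ E]
    [FiniteDimensional ℝ E] [MeasurableSpace E] [BorelSpace E] (u : E) :
    ∫ z, inner ℝ u z ^ 2 ∂stdGaussian E = ‖u‖ ^ 2 := by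
  have h := variance_dual_stdGaussian (innerSL ℝ u)
  rw [variance_of_integral_eq_zero (by fun_prop)
    (by simpa using integral_inner_stdGaussian u), innerSL_apply_norm] at h
  simpa using h

/-- The fourth moment of the standard normal distribution. -/
noncomputable def gaussFourth : ℝ := ∫ x, x ^ 4 ∂gaussianReal 0 1

lemma gaussFourth_nonneg : 0 ≤ gaussFourth := integral_nonneg fun x => by positivity

lemma integral_norm_sq_stdGaussian (k : ℕ) :
    ∫ z, ‖z‖ ^ 2 ∂stdGaussian (Vec k) = k := by
  have hi : ∀ i : Fin k, Integrable (fun z : Vec k => z i ^ 2) (stdGaussian (Vec k)) := fun i => by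
    refine (integrable_norm_pow_stdGaussian (E := Vec k) 2).mono' (by fun_prop) (ae_of_all _ ?_)
    intro z
    rw [norm_pow]
    exact pow_le_pow_left₀ (norm_nonneg _) (PiLp.norm_apply_le z i) 2
  simp only [EuclideanSpace.norm_sq_eq, Real.norm_eq_abs, sq_abs]
  rw [integral_finsetSum _ fun i _ => hi i]
  have : ∀ i : Fin k, ∫ z : Vec k, z i ^ 2 ∂stdGaussian (Vec k) = 1 := fun i => by
    have := integral_inner_sq_stdGaussian (EuclideanSpace.single i (1 : ℝ))
    simpa [EuclideanSpace.inner_single_left] using this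
  simp [this]

lemma integral_norm_pow_four_stdGaussian_le (k : ℕ) :
    ∫ z, ‖z‖ ^ 4 ∂stdGaussian (Vec k) ≤ gaussFourth * k ^ 2 := by
  have hi : ∀ i : Fin k, Integrable (fun z : Vec k => z i ^ 4) (stdGaussian (Vec k)) := fun i => by
    refine (integrable_norm_pow_stdGaussian (E := Vec k) 4).mono' (by fun_prop) (ae_of_all _ ?_)
    intro z
    rw [norm_pow]
    exact pow_le_pow_left₀ (norm_nonneg _) (PiLp.norm_apply_le z i) 4
  have h4 : ∀ i : Fin k, ∫ z : Vec k, z i ^ 4 ∂stdGaussian (Vec k) = gaussFourth := fun i => by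
    have := map_inner_stdGaussian (EuclideanSpace.single i (1 : ℝ))
    simp only [PiLp.norm_single, norm_one, one_pow, Real.toNNReal_one] at this
    rw [gaussFourth, ← this, integral_map (by fun_prop) (by fun_prop)]
    simp [EuclideanSpace.inner_single_left]
  calc ∫ z, ‖z‖ ^ 4 ∂stdGaussian (Vec k)
      ≤ ∫ z : Vec k, k * ∑ i, z i ^ 4 ∂stdGaussian (Vec k) := by
        refine integral_mono (integrable_norm_pow_stdGaussian 4)
          ((integrable_finsetSum _ fun i _ => hi i).const_mul _) fun z => ?_
        have hz : ‖z‖ ^ 4 = (∑ i, z i ^ 2) ^ 2 := by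
          rw [show ‖z‖ ^ 4 = (‖z‖ ^ 2) ^ 2 by ring, EuclideanSpace.norm_sq_eq]
          simp
        have := sq_sum_le_card_mul_sum_sq (s := Finset.univ) (f := fun i => z i ^ 2)
        simp only [hz]
        refine this.trans (le_of_eq ?_)
        simp [← pow_mul]
    _ = gaussFourth * k ^ 2 := by
        rw [integral_const_mul, integral_finsetSum _ fun i _ => hi i]
        simp [h4]; ring

lemma integral_norm_pow_three_stdGaussian_le (k : ℕ) :
    ∫ z, ‖z‖ ^ 3 ∂stdGaussian (Vec k) ≤ (1 + gaussFourth) * (k * √k) := by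
  rcases Nat.eq_zero_or_pos k with rfl | hk
  · have : ∀ z : Vec 0, z = 0 := fun z => Subsingleton.elim _ _
    simp [this]
  have hs : 0 < √(k : ℝ) := Real.sqrt_pos.2 (by exact_mod_cast hk)
  have hss : √(k : ℝ) * √(k : ℝ) = k := Real.mul_self_sqrt (by positivity)
  have hpt : ∀ z : Vec k, ‖z‖ ^ 3 ≤ √k * ‖z‖ ^ 2 + ‖z‖ ^ 4 / √k := by
    intro z
    have h0 := norm_nonneg z
    have : √(k : ℝ) * ‖z‖ ^ 3 ≤ √k * (√k * ‖z‖ ^ 2 + ‖z‖ ^ 4 / √k) := by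
      have : √(k : ℝ) * (√k * ‖z‖ ^ 2 + ‖z‖ ^ 4 / √k) = √k ^ 2 * ‖z‖ ^ 2 + ‖z‖ ^ 4 := by
        field_simp
      rw [this]
      have h1 : 0 ≤ ‖z‖ ^ 2 * ((√k - ‖z‖) ^ 2 + √k * ‖z‖) := by positivity
      nlinarith
    exact le_of_mul_le_mul_left this hs
  calc ∫ z, ‖z‖ ^ 3 ∂stdGaussian (Vec k)
      ≤ ∫ z : Vec k, (√k * ‖z‖ ^ 2 + ‖z‖ ^ 4 / √k) ∂stdGaussian (Vec k) :=
        integral_mono (integrable_norm_pow_stdGaussian 3)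
          (((integrable_norm_pow_stdGaussian 2).const_mul _).add
            ((integrable_norm_pow_stdGaussian 4).div_const _)) hpt
    _ = √k * k + (∫ z, ‖z‖ ^ 4 ∂stdGaussian (Vec k)) / √k := by
        rw [integral_add ((integrable_norm_pow_stdGaussian 2).const_mul _)
          ((integrable_norm_pow_stdGaussian 4).div_const _), integral_const_mul, integral_div,
          integral_norm_sq_stdGaussian]
    _ ≤ √k * k + gaussFourth * k ^ 2 / √k := by
        gcongr
        exact integral_norm_pow_four_stdGaussian_le k
    _ = (1 + gaussFourth) * (k * √k) := by
        have : (k : ℝ) ^ 2 / √k = k * √k := by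
          rw [div_eq_iff hs.ne']
          nlinarith
        rw [mul_div_assoc, this]; ring

lemma conv_map_smul_stdGaussian {E : Type*} [NormedAddCommGroup E] [InnerProductSpace ℝ E]
    [FiniteDimensional ℝ E] [MeasurableSpace E] [BorelSpace E] {a b : ℝ} (ha : 0 ≤ a)
    (hb : 0 ≤ b) :
    ((stdGaussian E).map (√a • ·)).conv ((stdGaussian E).map (√b • ·)) =
      (stdGaussian E).map (√(a + b) • ·) := by
  have h : ∀ c : ℝ, IsProbabilityMeasure ((stdGaussian E).map (c • ·)) := fun c =>
    Measure.isProbabilityMeasure_map (by fun_prop)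
  have := h √a
  have := h √b
  have := h √(a + b)
  refine Measure.ext_of_charFun ?_
  ext t
  rw [charFun_conv, charFun_map_smul, charFun_map_smul, charFun_map_smul]
  simp only [charFun_stdGaussian, ← Complex.exp_add]
  congr 1
  have e : ∀ c : ℝ, 0 ≤ c → (‖√c • t‖ ^ 2 : ℝ) = c * ‖t‖ ^ 2 := fun c hc => by
    rw [norm_smul, mul_pow, Real.norm_eq_abs, sq_abs, Real.sq_sqrt hc]
  have e' : ∀ c : ℝ, 0 ≤ c → ((‖√c • t‖ : ℂ) ^ 2) = c * ‖t‖ ^ 2 := fun c hc => by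
    exact_mod_cast e c hc
  rw [e' a ha, e' b hb, e' _ (add_nonneg ha hb)]
  push_cast
  ring

/-! ### Gaussian smoothing and its second-order Taylor expansion -/

/-- The convolution `x ↦ E g(x + √τ Z)` of `g` with a centered Gaussian of covariance `τ I`. -/
noncomputable def gaussSmooth {E : Type*} [NormedAddCommGroup E] [InnerProductSpace ℝ E]
    [FiniteDimensional ℝ E] [MeasurableSpace E] [BorelSpace E] (g : E → ℝ) (τ : ℝ) (x : E) : ℝ :=
  ∫ z, g (x + √τ • z) ∂stdGaussian E

/-- Taylor's formula with integral remainder at `0` for `t ↦ exp (t s - t² c / 2)`, whose second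
derivative is `((s - t c)² - c) exp (t s - t² c / 2)`. -/
lemma exp_taylor (s c : ℝ) :
    Real.exp (s - c / 2) - 1 - s - (s ^ 2 - c) / 2 =
      ∫ t in (0 : ℝ)..1, (1 - t) *
        (((s - t * c) ^ 2 - c) * Real.exp (t * s - t ^ 2 * c / 2) - (s ^ 2 - c)) := by
  let e : ℝ → ℝ := fun t => Real.exp (t * s - t ^ 2 * c / 2)
  have he : ∀ t, HasDerivAt e (e t * (s - t * c)) t := by
    intro t
    have h1 : HasDerivAt (fun t : ℝ => t * s - t ^ 2 * c / 2) (s - t * c) t := by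
      have := ((hasDerivAt_id t).mul_const s).sub
        ((((hasDerivAt_id t).pow 2).mul_const c).div_const 2)
      refine this.congr_deriv ?_
      simp
      ring
    exact h1.exp
  have hF : ∀ t, HasDerivAt (fun t => (1 - t) * (e t * (s - t * c)) + e t -
      (s ^ 2 - c) * (t - t ^ 2 / 2))
      ((1 - t) * (((s - t * c) ^ 2 - c) * Real.exp (t * s - t ^ 2 * c / 2) - (s ^ 2 - c))) t := by
    intro t
    have h2 : HasDerivAt (fun t : ℝ => s - t * c) (-c) t := by
      simpa using ((hasDerivAt_id t).mul_const c).const_sub s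
    have h3 : HasDerivAt (fun t : ℝ => 1 - t) (-1) t := by
      simpa using (hasDerivAt_id t).const_sub (1 : ℝ)
    have h4 : HasDerivAt (fun t : ℝ => (s ^ 2 - c) * (t - t ^ 2 / 2))
        ((s ^ 2 - c) * (1 - t)) t := by
      have := ((hasDerivAt_id t).sub (((hasDerivAt_id t).pow 2).div_const 2)).const_mul (s ^ 2 - c)
      refine this.congr_deriv ?_
      simp
    refine (((h3.mul ((he t).mul h2)).add (he t)).sub h4).congr_deriv ?_
    simp only [e, Pi.mul_apply]
    ring
  rw [intervalIntegral.integral_eq_sub_of_hasDerivAt (fun t _ => hF t)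
    (Continuous.intervalIntegrable (by fun_prop) _ _)]
  simp only [e]
  norm_num
  ring

/-- The linear part of `gaussSmooth g τ (x + h)`. -/
noncomputable def smoothLin {E : Type*} [NormedAddCommGroup E] [InnerProductSpace ℝ E]
    [FiniteDimensional ℝ E] [MeasurableSpace E] [BorelSpace E] (g : E → ℝ) (τ : ℝ) (x h : E) : ℝ :=
  ∫ z, g (x + √τ • z) * inner ℝ ((√τ)⁻¹ • h) z ∂stdGaussian E

/-- The second derivative of `gaussSmooth g τ` at `x`, as a quadratic form in `h`. -/
noncomputable def smoothQuad {E : Type*} [NormedAddCommGroup E] [InnerProductSpace ℝ E]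
    [FiniteDimensional ℝ E] [MeasurableSpace E] [BorelSpace E] (g : E → ℝ) (τ : ℝ) (x h : E) : ℝ :=
  ∫ z, g (x + √τ • z) * (inner ℝ ((√τ)⁻¹ • h) z ^ 2 - ‖(√τ)⁻¹ • h‖ ^ 2) ∂stdGaussian E

lemma integrable_inner_sq_stdGaussian {E : Type*} [NormedAddCommGroup E] [InnerProductSpace ℝ E]
    [FiniteDimensional ℝ E] [MeasurableSpace E] [BorelSpace E] (u : E) :
    Integrable (fun z => inner ℝ u z ^ 2) (stdGaussian E) := by
  refine ((integrable_norm_pow_stdGaussian (E := E) 2).const_mul (‖u‖ ^ 2)).mono' (by fun_prop)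
    (ae_of_all _ fun z => ?_)
  rw [norm_pow, ← mul_pow]
  exact pow_le_pow_left₀ (norm_nonneg _) (norm_inner_le_norm u z) 2

lemma integrable_inner_stdGaussian {E : Type*} [NormedAddCommGroup E] [InnerProductSpace ℝ E]
    [FiniteDimensional ℝ E] [MeasurableSpace E] [BorelSpace E] (u : E) :
    Integrable (fun z => inner ℝ u z) (stdGaussian E) :=
  (IsGaussian.integrable_id (μ := stdGaussian E)).const_inner u

lemma abs_exp_second_deriv_le {s c t : ℝ} (hc : 0 ≤ c) (ht0 : 0 ≤ t) (ht1 : t ≤ 1) :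
    |((s - t * c) ^ 2 - c) * Real.exp (t * s - t ^ 2 * c / 2)| ≤
      (2 * Real.exp c + c) * (Real.exp (2 * s) + Real.exp (-(2 * s))) := by
  have h1 : |s - t * c| ≤ |s| + c := by
    refine (abs_sub _ _).trans ?_
    rw [abs_mul, abs_of_nonneg ht0, abs_of_nonneg hc]
    nlinarith
  have h2 : (|s| + c) ^ 2 ≤ 2 * (Real.exp c * Real.exp |s|) := by
    have := Real.quadratic_le_exp_of_nonneg (x := |s| + c) (by positivity)
    rw [Real.exp_add] at this
    nlinarith [abs_nonneg s]
  have h3 : (1 : ℝ) ≤ Real.exp |s| := Real.one_le_exp (abs_nonneg s)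
  have h4 : |(s - t * c) ^ 2 - c| ≤ (2 * Real.exp c + c) * Real.exp |s| := by
    have h5 : (s - t * c) ^ 2 ≤ (|s| + c) ^ 2 := by
      rw [← sq_abs (s - t * c)]
      exact pow_le_pow_left₀ (abs_nonneg _) h1 2
    have h6 : 0 ≤ Real.exp c * Real.exp |s| := by positivity
    rw [abs_le]
    constructor <;> nlinarith [sq_nonneg (s - t * c)]
  have h7 : Real.exp (t * s - t ^ 2 * c / 2) ≤ Real.exp |s| := by
    refine Real.exp_le_exp.2 ?_
    have : t * s ≤ |s| := by nlinarith [le_abs_self s, neg_abs_le s, abs_nonneg s]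
    have : 0 ≤ t ^ 2 * c / 2 := by positivity
    linarith
  have h8 : Real.exp |s| * Real.exp |s| ≤ Real.exp (2 * s) + Real.exp (-(2 * s)) := by
    rw [← Real.exp_add]
    rcases abs_cases s with ⟨h, -⟩ | ⟨h, -⟩
    · rw [h, ← two_mul]
      linarith [Real.exp_pos (-(2 * s))]
    · rw [h, show -s + -s = -(2 * s) by ring]
      linarith [Real.exp_pos (2 * s)]
  rw [abs_mul, abs_of_pos (Real.exp_pos _)]
  calc |(s - t * c) ^ 2 - c| * Real.exp (t * s - t ^ 2 * c / 2)
      ≤ ((2 * Real.exp c + c) * Real.exp |s|) * Real.exp |s| :=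
        mul_le_mul h4 h7 (Real.exp_pos _).le (by positivity)
    _ = (2 * Real.exp c + c) * (Real.exp |s| * Real.exp |s|) := by ring
    _ ≤ _ := mul_le_mul_of_nonneg_left h8 (by positivity)

/-- The remainder in the second-order Taylor expansion of a Gaussian average along `u` is
dimension-free. By the Cameron–Martin formula the average of `G (z + u)` is that of
`G z exp (⟨u, z⟩ - ‖u‖² / 2)`, the exponential is expanded by `exp_taylor`, and a second use of the
formula turns the remainder into an average of `(G (z + t u) - G z) (⟨u, z⟩² - ‖u‖²)`. -/
theorem abs_integral_add_stdGaussian_taylor_le {E : Type*} [NormedAddCommGroup E]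
    [InnerProductSpace ℝ E] [FiniteDimensional ℝ E] [MeasurableSpace E] [BorelSpace E] {G : E → ℝ}
    {M L : ℝ} (hGm : Measurable G) (hM : ∀ z, |G z| ≤ M)
    (hL : ∀ z w, |G z - G w| ≤ L * ‖z - w‖) (u : E) :
    |∫ z, G (z + u) ∂stdGaussian E - ∫ z, G z ∂stdGaussian E -
      ∫ z, G z * inner ℝ u z ∂stdGaussian E -
      (∫ z, G z * (inner ℝ u z ^ 2 - ‖u‖ ^ 2) ∂stdGaussian E) / 2| ≤ 2 * L * ‖u‖ ^ 3 := by
  set γ := stdGaussian E with hγ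
  set c : ℝ := ‖u‖ ^ 2 with hc
  have hc0 : 0 ≤ c := by positivity
  have hM0 : 0 ≤ M := (abs_nonneg _).trans (hM 0)
  have hbdd : ∀ {f : E → ℝ}, Integrable f γ → Integrable (fun z => G z * f z) γ := fun hf =>
    hf.bdd_mul hGm.aestronglyMeasurable (ae_of_all _ fun z => by simpa using hM z)
  have hi1 := hbdd (integrable_inner_stdGaussian u)
  have hi2 : Integrable (fun z => inner ℝ u z ^ 2 - c) γ :=
    (integrable_inner_sq_stdGaussian u).sub (integrable_const c)
  have hi2' := hbdd hi2
  have hi0 : Integrable G γ := by simpa using hbdd (integrable_const (1 : ℝ))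
  have hiexp : Integrable (fun z => Real.exp (inner ℝ u z - c / 2)) γ := by
    simp only [Real.exp_sub]
    exact (integrable_exp_inner_stdGaussian u).div_const _
  have hie := hbdd hiexp
  let k : ℝ → E → ℝ := fun t z =>
    (((inner ℝ u z - t * c) ^ 2 - c) * Real.exp (t * inner ℝ u z - t ^ 2 * c / 2) -
      (inner ℝ u z ^ 2 - c))
  -- The left-hand side, as an average of the remainder of `exp_taylor`.
  have hstep1 : ∫ z, G (z + u) ∂γ - ∫ z, G z ∂γ - ∫ z, G z * inner ℝ u z ∂γ -
      (∫ z, G z * (inner ℝ u z ^ 2 - c) ∂γ) / 2 =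
      ∫ z, (∫ t in Set.Ioc (0 : ℝ) 1, G z * ((1 - t) * k t z)) ∂γ := by
    rw [hγ, integral_add_stdGaussian u hGm, ← hγ, ← integral_div]
    have : ∀ z, Real.exp (inner ℝ u z - ‖u‖ ^ 2 / 2) * G z =
        G z * Real.exp (inner ℝ u z - c / 2) := fun z => mul_comm _ _
    simp only [this]
    have hj1 : Integrable (fun z => G z * Real.exp (inner ℝ u z - c / 2) - G z) γ := hie.sub hi0
    have hj2 : Integrable (fun z => G z * Real.exp (inner ℝ u z - c / 2) - G z -
        G z * inner ℝ u z) γ := hj1.sub hi1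
    rw [← integral_sub hie hi0, ← integral_sub hj1 hi1, ← integral_sub hj2 (hi2'.div_const 2)]
    refine integral_congr_ae (ae_of_all _ fun z => ?_)
    simp only
    rw [integral_const_mul, ← intervalIntegral.integral_of_le zero_le_one, ← exp_taylor]
    ring
  have hbound : ∀ t ∈ Set.Ioc (0 : ℝ) 1, ∀ z, ‖G z * ((1 - t) * k t z)‖ ≤
      M * ((2 * Real.exp c + c) * (Real.exp (inner ℝ ((2 : ℝ) • u) z) +
        Real.exp (inner ℝ (-((2 : ℝ) • u)) z)) + |inner ℝ u z ^ 2 - c|) := by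
    intro t ht z
    have h1 := abs_exp_second_deriv_le (s := inner ℝ u z) hc0 ht.1.le ht.2
    rw [inner_neg_left, real_inner_smul_left, norm_mul, norm_mul, Real.norm_eq_abs,
      Real.norm_eq_abs, Real.norm_eq_abs]
    have h2 : |1 - t| ≤ 1 := by rw [abs_le]; constructor <;> linarith [ht.1, ht.2]
    refine mul_le_mul (hM z) ?_ (by positivity) hM0
    calc |1 - t| * |k t z| ≤ 1 * |k t z| := mul_le_mul_of_nonneg_right h2 (abs_nonneg _)
      _ ≤ _ := by
        rw [one_mul]
        exact (abs_sub _ _).trans (add_le_add_left h1 _)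
  have hibound : Integrable (fun z => M * ((2 * Real.exp c + c) *
      (Real.exp (inner ℝ ((2 : ℝ) • u) z) +
        Real.exp (inner ℝ (-((2 : ℝ) • u)) z)) + |inner ℝ u z ^ 2 - c|)) γ :=
    ((((integrable_exp_inner_stdGaussian _).add
      (integrable_exp_inner_stdGaussian _)).const_mul _).add hi2.abs).const_mul M
  have hkm : Measurable fun q : E × ℝ => G q.1 * ((1 - q.2) * k q.2 q.1) := by
    have : Measurable fun q : E × ℝ => (1 - q.2) * k q.2 q.1 := by
      have : Continuous fun q : E × ℝ => (1 - q.2) * k q.2 q.1 := by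
        simp only [k]
        fun_prop
      exact this.measurable
    exact (hGm.comp measurable_fst).mul this
  have hprod : Integrable (fun q : E × ℝ => G q.1 * ((1 - q.2) * k q.2 q.1))
      (γ.prod (volume.restrict (Set.Ioc (0 : ℝ) 1))) := by
    refine (hibound.comp_fst (volume.restrict (Set.Ioc (0 : ℝ) 1))).mono'
      hkm.aestronglyMeasurable ?_
    have : ∀ᵐ q ∂(γ.prod (volume.restrict (Set.Ioc (0 : ℝ) 1))), q.2 ∈ Set.Ioc (0 : ℝ) 1 :=
      Measure.quasiMeasurePreserving_snd.ae (ae_restrict_mem measurableSet_Ioc)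
    filter_upwards [this] with q hq using hbound q.2 hq q.1
  have hinner : ∀ t ∈ Set.Ioc (0 : ℝ) 1,
      ‖∫ z, G z * ((1 - t) * k t z) ∂γ‖ ≤ 2 * L * ‖u‖ ^ 3 := by
    intro t ht
    -- Cameron–Martin for the shift `t u`.
    have hshift : ∫ z, G (z + t • u) * (inner ℝ u z ^ 2 - c) ∂γ =
        ∫ z, G z * (((inner ℝ u z - t * c) ^ 2 - c) *
          Real.exp (t * inner ℝ u z - t ^ 2 * c / 2)) ∂γ := by
      have := integral_add_stdGaussian (t • u)
        (g := fun z => G z * ((inner ℝ u z - t * c) ^ 2 - c)) (by fun_prop)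
      rw [← hγ] at this
      simp only [inner_add_right, real_inner_smul_right, real_inner_smul_left,
        real_inner_self_eq_norm_sq, norm_smul, mul_pow, Real.norm_eq_abs, sq_abs] at this
      rw [← hc] at this
      simp only [add_sub_cancel_right] at this
      rw [this]
      exact integral_congr_ae (ae_of_all _ fun z => by ring)
    have hGs : Integrable (fun z => G (z + t • u) * (inner ℝ u z ^ 2 - c)) γ :=
      hi2.bdd_mul (hGm.comp (by fun_prop)).aestronglyMeasurable
        (ae_of_all _ fun z => by simpa using hM _)
    have hGe : Integrable (fun z => G z * (((inner ℝ u z - t * c) ^ 2 - c) *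
        Real.exp (t * inner ℝ u z - t ^ 2 * c / 2))) γ := by
      refine hbdd ?_
      refine (((integrable_exp_inner_stdGaussian ((2 : ℝ) • u)).add
        (integrable_exp_inner_stdGaussian (-((2 : ℝ) • u)))).const_mul
          (2 * Real.exp c + c)).mono' (by fun_prop) (ae_of_all _ fun z => ?_)
      have := abs_exp_second_deriv_le (s := inner ℝ u z) hc0 ht.1.le ht.2
      simp only [Pi.add_apply]
      rw [inner_neg_left, real_inner_smul_left]
      exact this
    have heq : ∫ z, G z * ((1 - t) * k t z) ∂γ =
        (1 - t) * ∫ z, (G (z + t • u) - G z) * (inner ℝ u z ^ 2 - c) ∂γ := by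
      have e1 : ∀ z, G z * ((1 - t) * k t z) = (1 - t) * (G z * (((inner ℝ u z - t * c) ^ 2 - c) *
          Real.exp (t * inner ℝ u z - t ^ 2 * c / 2)) - G z * (inner ℝ u z ^ 2 - c)) := fun z => by
        simp only [k]; ring
      simp only [e1, sub_mul (G _) (G _)]
      rw [integral_const_mul, integral_sub hGe hi2', integral_sub hGs hi2', hshift]
    rw [heq, norm_mul]
    have hL0 : 0 ≤ L * ‖t • u‖ := by
      have := (abs_nonneg _).trans (hL (t • u) 0)
      simpa using this
    have hLu : L * ‖t • u‖ ≤ L * ‖u‖ := by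
      rw [norm_smul, Real.norm_eq_abs, abs_of_pos ht.1] at hL0 ⊢
      have : 0 ≤ L * ‖u‖ := by
        have h := ht.1
        by_contra hneg
        push Not at hneg
        nlinarith
      nlinarith [ht.2]
    have h2 : ‖∫ z, (G (z + t • u) - G z) * (inner ℝ u z ^ 2 - c) ∂γ‖ ≤ L * ‖u‖ * (2 * c) := by
      calc ‖∫ z, (G (z + t • u) - G z) * (inner ℝ u z ^ 2 - c) ∂γ‖
          ≤ ∫ z, L * ‖u‖ * (inner ℝ u z ^ 2 + c) ∂γ := by
            refine norm_integral_le_of_norm_le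
              (((integrable_inner_sq_stdGaussian u).add (integrable_const c)).const_mul _)
              (ae_of_all _ fun z => ?_)
            rw [norm_mul]
            refine mul_le_mul ?_ ?_ (norm_nonneg _) (hL0.trans hLu)
            · refine (hL _ _).trans ?_
              simpa using hLu
            · rw [Real.norm_eq_abs, abs_le]
              constructor <;> nlinarith [sq_nonneg (inner ℝ u z)]
        _ = L * ‖u‖ * (2 * c) := by
            rw [integral_const_mul, integral_add (integrable_inner_sq_stdGaussian u)
              (integrable_const c), integral_inner_sq_stdGaussian, ← hc,
              integral_const, probReal_univ, one_smul]
            ring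
    have h3 : ‖1 - t‖ ≤ 1 := by
      rw [Real.norm_eq_abs, abs_le]; constructor <;> linarith [ht.1, ht.2]
    calc ‖1 - t‖ * ‖∫ z, (G (z + t • u) - G z) * (inner ℝ u z ^ 2 - c) ∂γ‖
        ≤ 1 * (L * ‖u‖ * (2 * c)) := mul_le_mul h3 h2 (norm_nonneg _) zero_le_one
      _ = 2 * L * ‖u‖ ^ 3 := by rw [hc]; ring
  rw [hstep1, integral_integral_swap hprod, ← Real.norm_eq_abs]
  have := norm_setIntegral_le_of_norm_le_const (μ := volume) (s := Set.Ioc (0 : ℝ) 1)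
    (f := fun t => ∫ z, G z * ((1 - t) * k t z) ∂γ) (by simp) hinner
  simpa using this

theorem abs_gaussSmooth_taylor_le {E : Type*} [NormedAddCommGroup E]
    [InnerProductSpace ℝ E] [FiniteDimensional ℝ E] [MeasurableSpace E] [BorelSpace E] {g : E → ℝ}
    {M L τ : ℝ} (hgm : Measurable g) (hM : ∀ z, |g z| ≤ M)
    (hL : ∀ z w, |g z - g w| ≤ L * ‖z - w‖) (hτ : 0 < τ) (x h : E) :
    |gaussSmooth g τ (x + h) - gaussSmooth g τ x - smoothLin g τ x h - smoothQuad g τ x h / 2| ≤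
      2 * L * ‖h‖ ^ 3 / τ := by
  have hs : 0 < √τ := Real.sqrt_pos.2 hτ
  have hss : √τ * √τ = τ := Real.mul_self_sqrt hτ.le
  have key := abs_integral_add_stdGaussian_taylor_le (G := fun z => g (x + √τ • z)) (M := M)
    (L := L * √τ) (hgm.comp (by fun_prop)) (fun z => hM _) (fun z w => by
      refine (hL _ _).trans (le_of_eq ?_)
      rw [add_sub_add_left_eq_sub, ← smul_sub, norm_smul, Real.norm_eq_abs, abs_of_pos hs]
      ring) ((√τ)⁻¹ • h)
  have e1 : ∀ z : E, x + √τ • (z + (√τ)⁻¹ • h) = x + h + √τ • z := fun z => by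
    rw [smul_add, smul_inv_smul₀ hs.ne']; abel
  simp only [e1] at key
  refine key.trans (le_of_eq ?_)
  rw [norm_smul, norm_inv, Real.norm_eq_abs, abs_of_pos hs]
  have : 2 * L * ‖h‖ ^ 3 / τ = 2 * L * ‖h‖ ^ 3 / (√τ * √τ) := by rw [hss]
  rw [this]
  field_simp

/-! ### The Lindeberg replacement argument -/

lemma measurable_gaussSmooth {E : Type*} [NormedAddCommGroup E] [InnerProductSpace ℝ E]
    [FiniteDimensional ℝ E] [MeasurableSpace E] [BorelSpace E] {g : E → ℝ} (hg : Measurable g)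
    (τ : ℝ) : Measurable (gaussSmooth g τ) := by
  have h : StronglyMeasurable fun q : E × E => g (q.1 + √τ • q.2) :=
    (hg.comp (by fun_prop)).stronglyMeasurable
  exact (h.integral_prod_right (ν := stdGaussian E)).measurable

lemma abs_gaussSmooth_le {E : Type*} [NormedAddCommGroup E] [InnerProductSpace ℝ E]
    [FiniteDimensional ℝ E] [MeasurableSpace E] [BorelSpace E] {g : E → ℝ} {M : ℝ}
    (hM : ∀ z, |g z| ≤ M) (τ : ℝ) (x : E) : |gaussSmooth g τ x| ≤ M := by
  have := norm_integral_le_of_norm_le_const (μ := stdGaussian E)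
    (f := fun z => g (x + √τ • z)) (C := M) (ae_of_all _ fun z => by simpa using hM _)
  simpa [gaussSmooth] using this

lemma integrable_of_measurable_of_abs_le {Ω : Type*} [MeasurableSpace Ω] {μ : Measure Ω}
    [IsFiniteMeasure μ] {f : Ω → ℝ} (hf : Measurable f) {M : ℝ} (hM : ∀ z, |f z| ≤ M) :
    Integrable f μ :=
  (integrable_const M).mono' hf.aestronglyMeasurable (ae_of_all _ fun z => by simpa using hM z)

/-- The Gaussian smoothings form a convolution semigroup. -/
lemma integral_gaussSmooth_add {E : Type*} [NormedAddCommGroup E] [InnerProductSpace ℝ E]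
    [FiniteDimensional ℝ E] [MeasurableSpace E] [BorelSpace E] {g : E → ℝ} {M : ℝ}
    (hg : Measurable g) (hM : ∀ z, |g z| ≤ M) {τ s : ℝ} (hτ : 0 ≤ τ) (hs : 0 ≤ s) (x : E) :
    ∫ z, gaussSmooth g τ (x + √s • z) ∂stdGaussian E = gaussSmooth g (τ + s) x := by
  have hp : ∀ c : ℝ, IsProbabilityMeasure ((stdGaussian E).map (c • ·)) := fun c =>
    Measure.isProbabilityMeasure_map (by fun_prop)
  have := hp √τ
  have := hp √s
  have hgx : Measurable fun y => g (x + y) := hg.comp (by fun_prop)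
  have h1 : ∫ y, g (x + y) ∂((stdGaussian E).map (√(τ + s) • ·)) = gaussSmooth g (τ + s) x := by
    rw [integral_map (by fun_prop) hgx.aestronglyMeasurable]
    rfl
  rw [← h1, add_comm τ s, ← conv_map_smul_stdGaussian hs hτ, integral_conv
    (integrable_of_measurable_of_abs_le hgx fun z => hM _)]
  have h2 : ∀ y : E, ∫ w, g (x + (y + w)) ∂((stdGaussian E).map (√τ • ·)) =
      gaussSmooth g τ (x + y) := fun y => by
    rw [integral_map (by fun_prop) (Measurable.aestronglyMeasurable (by fun_prop))]
    simp only [gaussSmooth, add_assoc]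
  have h3 := measurable_gaussSmooth hg τ
  simp only [h2]
  rw [integral_map (by fun_prop) (Measurable.aestronglyMeasurable (by fun_prop))]

lemma smoothLin_eq_inner {E : Type*} [NormedAddCommGroup E] [InnerProductSpace ℝ E]
    [FiniteDimensional ℝ E] [MeasurableSpace E] [BorelSpace E] {g : E → ℝ} {M : ℝ}
    (hg : Measurable g) (hM : ∀ z, |g z| ≤ M) (τ : ℝ) (x h : E) :
    smoothLin g τ x h = inner ℝ (∫ z, ((√τ)⁻¹ * g (x + √τ • z)) • z ∂stdGaussian E) h := by
  have hi : Integrable (fun z => ((√τ)⁻¹ * g (x + √τ • z)) • z) (stdGaussian E) := by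
    have : Integrable (fun z => z) (stdGaussian E) := IsGaussian.integrable_id
    refine this.bdd_smul (|(√τ)⁻¹| * M) ?_ (ae_of_all _ fun z => ?_)
    · exact ((hg.comp (by fun_prop)).const_mul _).aestronglyMeasurable
    · rw [norm_mul]
      exact mul_le_mul_of_nonneg_left (hM _) (abs_nonneg _)
  rw [real_inner_comm, ← integral_inner hi, smoothLin]
  refine integral_congr_ae (ae_of_all _ fun z => ?_)
  simp only [real_inner_smul_left, real_inner_smul_right]
  ring

lemma integrable_norm_pow_of_le_three {Ω E : Type*} [MeasurableSpace Ω] [NormedAddCommGroup E]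
    [MeasurableSpace E] [BorelSpace E] {μ : Measure Ω} [IsFiniteMeasure μ] {ξ : Ω → E}
    (hξ : Measurable ξ) (h3 : Integrable (fun y => ‖ξ y‖ ^ 3) μ) {m : ℕ} (hm : m ≤ 3) :
    Integrable (fun y => ‖ξ y‖ ^ m) μ := by
  refine ((integrable_const (1 : ℝ)).add h3).mono'
    (hξ.norm.pow_const m).aestronglyMeasurable (ae_of_all _ fun y => ?_)
  rw [norm_pow, norm_norm]
  rcases le_total ‖ξ y‖ 1 with h | h
  · have := pow_le_one₀ (n := m) (norm_nonneg (ξ y)) h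
    have : 0 ≤ ‖ξ y‖ ^ 3 := by positivity
    simp only [Pi.add_apply]
    linarith
  · have := pow_le_pow_right₀ h hm
    simp only [Pi.add_apply]
    linarith

lemma integrable_inner_of_norm_pow_three {E : Type*} [NormedAddCommGroup E]
    [InnerProductSpace ℝ E] [FiniteDimensional ℝ E] [MeasurableSpace E] [BorelSpace E]
    {μ : Measure E} [IsFiniteMeasure μ] (h3 : Integrable (fun y => ‖y‖ ^ 3) μ) (v : E) :
    Integrable (fun y => inner ℝ v y) μ := by
  have h1 := integrable_norm_pow_of_le_three (ξ := fun y => y) measurable_id h3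
    (show 1 ≤ 3 by norm_num)
  refine (h1.const_mul ‖v‖).mono' (by fun_prop) (ae_of_all _ fun y => ?_)
  rw [pow_one]
  exact norm_inner_le_norm v y

lemma integrable_inner_sq_of_norm_pow_three {E : Type*} [NormedAddCommGroup E]
    [InnerProductSpace ℝ E] [FiniteDimensional ℝ E] [MeasurableSpace E] [BorelSpace E]
    {μ : Measure E} [IsFiniteMeasure μ] (h3 : Integrable (fun y => ‖y‖ ^ 3) μ) (v : E) :
    Integrable (fun y => inner ℝ v y ^ 2) μ := by
  have h1 := integrable_norm_pow_of_le_three (ξ := fun y => y) measurable_id h3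
    (show 2 ≤ 3 by norm_num)
  refine (h1.const_mul (‖v‖ ^ 2)).mono' (by fun_prop) (ae_of_all _ fun y => ?_)
  rw [norm_pow, ← mul_pow]
  exact pow_le_pow_left₀ (norm_nonneg _) (norm_inner_le_norm v y) 2

lemma integral_norm_sq_eq_sum_inner {E : Type*} [NormedAddCommGroup E]
    [InnerProductSpace ℝ E] [FiniteDimensional ℝ E] [MeasurableSpace E] [BorelSpace E]
    {μ : Measure E} [IsFiniteMeasure μ] (h3 : Integrable (fun y => ‖y‖ ^ 3) μ) :
    ∫ y, ‖y‖ ^ 2 ∂μ = ∑ i, ∫ y, inner ℝ (stdOrthonormalBasis ℝ E i) y ^ 2 ∂μ := by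
  rw [← integral_finsetSum _ fun i _ => integrable_inner_sq_of_norm_pow_three h3 _]
  refine integral_congr_ae (ae_of_all _ fun y => ?_)
  have := (stdOrthonormalBasis ℝ E).sum_sq_norm_inner_right y
  simp only [Real.norm_eq_abs, sq_abs] at this
  exact this.symm

lemma integrable_smoothQuad_kernel {E : Type*} [NormedAddCommGroup E] [InnerProductSpace ℝ E]
    [FiniteDimensional ℝ E] [MeasurableSpace E] [BorelSpace E] {g : E → ℝ} {M : ℝ}
    (hg : Measurable g) (hM : ∀ z, |g z| ≤ M) (τ : ℝ) (x : E) {μ : Measure E} [IsFiniteMeasure μ]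
    (h3 : Integrable (fun y => ‖y‖ ^ 3) μ) :
    Integrable (fun q : E × E => g (x + √τ • q.2) *
      (inner ℝ ((√τ)⁻¹ • q.1) q.2 ^ 2 - ‖(√τ)⁻¹ • q.1‖ ^ 2)) (μ.prod (stdGaussian E)) := by
  have h2 := integrable_norm_pow_of_le_three (ξ := fun y => y) measurable_id h3
    (show 2 ≤ 3 by norm_num)
  have hz : Integrable (fun z : E => ‖z‖ ^ 2 + 1) (stdGaussian E) :=
    (integrable_norm_pow_stdGaussian 2).add (integrable_const 1)
  refine ((h2.mul_prod hz).const_mul (M * (√τ)⁻¹ ^ 2)).mono' (by fun_prop)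
    (ae_of_all _ fun q => ?_)
  have h4 : |inner ℝ ((√τ)⁻¹ • q.1) q.2 ^ 2 - ‖(√τ)⁻¹ • q.1‖ ^ 2| ≤
      (√τ)⁻¹ ^ 2 * (‖q.1‖ ^ 2 * (‖q.2‖ ^ 2 + 1)) := by
    have h5 : inner ℝ ((√τ)⁻¹ • q.1) q.2 ^ 2 ≤ ‖(√τ)⁻¹ • q.1‖ ^ 2 * ‖q.2‖ ^ 2 := by
      rw [← mul_pow, ← sq_abs]
      exact pow_le_pow_left₀ (abs_nonneg _) (abs_real_inner_le_norm _ _) 2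
    have h6 : ‖(√τ)⁻¹ • q.1‖ ^ 2 = (√τ)⁻¹ ^ 2 * ‖q.1‖ ^ 2 := by
      rw [norm_smul, mul_pow, Real.norm_eq_abs, sq_abs]
    have h7 : 0 ≤ inner ℝ ((√τ)⁻¹ • q.1) q.2 ^ 2 := sq_nonneg _
    have h8 : 0 ≤ ‖(√τ)⁻¹ • q.1‖ ^ 2 := sq_nonneg _
    have h9 : 0 ≤ ‖(√τ)⁻¹ • q.1‖ ^ 2 * ‖q.2‖ ^ 2 := by positivity
    have h10 : (√τ)⁻¹ ^ 2 * (‖q.1‖ ^ 2 * (‖q.2‖ ^ 2 + 1)) =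
        ‖(√τ)⁻¹ • q.1‖ ^ 2 * ‖q.2‖ ^ 2 + ‖(√τ)⁻¹ • q.1‖ ^ 2 := by rw [h6]; ring
    rw [h10, abs_le]
    constructor <;> linarith
  rw [norm_mul, mul_assoc M]
  exact mul_le_mul (hM _) h4 (abs_nonneg _) ((abs_nonneg _).trans (hM 0))

/-- The mean over `μ` of the second-order Taylor term depends on `μ` only through its second
moments. -/
lemma integral_smoothQuad {E : Type*} [NormedAddCommGroup E] [InnerProductSpace ℝ E]
    [FiniteDimensional ℝ E] [MeasurableSpace E] [BorelSpace E] {g : E → ℝ} {M : ℝ}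
    (hg : Measurable g) (hM : ∀ z, |g z| ≤ M) (τ : ℝ) (x : E) {μ : Measure E} [IsFiniteMeasure μ]
    (h3 : Integrable (fun y => ‖y‖ ^ 3) μ) :
    Integrable (smoothQuad g τ x) μ ∧ ∫ y, smoothQuad g τ x y ∂μ =
      ∫ z, g (x + √τ • z) * ((√τ)⁻¹ ^ 2 * (∫ y, inner ℝ z y ^ 2 ∂μ - ∫ y, ‖y‖ ^ 2 ∂μ))
        ∂stdGaussian E := by
  have hk := integrable_smoothQuad_kernel hg hM τ x h3
  refine ⟨hk.integral_prod_left, ?_⟩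
  simp only [smoothQuad]
  rw [integral_integral_swap hk]
  refine integral_congr_ae (ae_of_all _ fun z => ?_)
  simp only [real_inner_smul_left, norm_smul, mul_pow, Real.norm_eq_abs, sq_abs, ← mul_sub]
  rw [integral_const_mul, integral_const_mul, integral_sub]
  · simp only [real_inner_comm]
  · simpa only [real_inner_comm] using integrable_inner_sq_of_norm_pow_three h3 z
  · exact integrable_norm_pow_of_le_three (ξ := fun y => y) measurable_id h3 (by norm_num)

lemma abs_integral_gaussSmooth_sub_le {E : Type*} [NormedAddCommGroup E] [InnerProductSpace ℝ E]
    [FiniteDimensional ℝ E] [MeasurableSpace E] [BorelSpace E] {g : E → ℝ} {M L τ : ℝ}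
    (hg : Measurable g) (hM : ∀ z, |g z| ≤ M) (hL : ∀ z w, |g z - g w| ≤ L * ‖z - w‖)
    (hτ : 0 < τ) (x : E) {μ : Measure E} [IsProbabilityMeasure μ]
    (h3 : Integrable (fun y => ‖y‖ ^ 3) μ) :
    |∫ y, gaussSmooth g τ (x + y) ∂μ - (gaussSmooth g τ x + ∫ y, smoothLin g τ x y ∂μ +
      (∫ y, smoothQuad g τ x y ∂μ) / 2)| ≤ 2 * L / τ * ∫ y, ‖y‖ ^ 3 ∂μ := by
  have hF : Integrable (fun y => gaussSmooth g τ (x + y)) μ :=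
    integrable_of_measurable_of_abs_le ((measurable_gaussSmooth hg τ).comp (by fun_prop))
      fun y => abs_gaussSmooth_le hM τ _
  have hl : Integrable (smoothLin g τ x) μ := by
    have : smoothLin g τ x = fun h => _ := funext fun h => smoothLin_eq_inner hg hM τ x h
    rw [this]
    exact integrable_inner_of_norm_pow_three h3 _
  have hq := (integral_smoothQuad hg hM τ x h3).1
  have h1 : Integrable (fun y => gaussSmooth g τ x + smoothLin g τ x y) μ :=
    (integrable_const _).add hl
  have h2 : Integrable (fun y => gaussSmooth g τ x + smoothLin g τ x y +
      smoothQuad g τ x y / 2) μ := h1.add (hq.div_const 2)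
  have heq : gaussSmooth g τ x + ∫ y, smoothLin g τ x y ∂μ + (∫ y, smoothQuad g τ x y ∂μ) / 2 =
      ∫ y, (gaussSmooth g τ x + smoothLin g τ x y + smoothQuad g τ x y / 2) ∂μ := by
    rw [integral_add h1 (hq.div_const 2), integral_add (integrable_const _) hl, integral_div]
    simp
  rw [heq, ← integral_sub hF h2, ← Real.norm_eq_abs, ← integral_const_mul]
  refine norm_integral_le_of_norm_le (h3.const_mul _) (ae_of_all _ fun y => ?_)
  have := abs_gaussSmooth_taylor_le hg hM hL hτ x y
  rw [Real.norm_eq_abs]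
  convert this using 1
  · congr 1; ring
  · ring

/-- One replacement step: measures with the same first and second moments. -/
lemma abs_integral_gaussSmooth_sub_integral_le {E : Type*} [NormedAddCommGroup E]
    [InnerProductSpace ℝ E] [FiniteDimensional ℝ E] [MeasurableSpace E] [BorelSpace E] {g : E → ℝ}
    {M L τ : ℝ} (hg : Measurable g) (hM : ∀ z, |g z| ≤ M)
    (hL : ∀ z w, |g z - g w| ≤ L * ‖z - w‖) (hτ : 0 < τ) (x : E) {μ ν : Measure E}
    [IsProbabilityMeasure μ] [IsProbabilityMeasure ν] (hμ3 : Integrable (fun y => ‖y‖ ^ 3) μ)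
    (hν3 : Integrable (fun y => ‖y‖ ^ 3) ν)
    (h1 : ∀ u : E, ∫ y, inner ℝ u y ∂μ = ∫ y, inner ℝ u y ∂ν)
    (h2 : ∀ u : E, ∫ y, inner ℝ u y ^ 2 ∂μ = ∫ y, inner ℝ u y ^ 2 ∂ν) :
    |∫ y, gaussSmooth g τ (x + y) ∂μ - ∫ y, gaussSmooth g τ (x + y) ∂ν| ≤
      2 * L / τ * (∫ y, ‖y‖ ^ 3 ∂μ + ∫ y, ‖y‖ ^ 3 ∂ν) := by
  have e1 : ∫ y, smoothLin g τ x y ∂μ = ∫ y, smoothLin g τ x y ∂ν := by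
    simp only [smoothLin_eq_inner hg hM, h1]
  have e2 : ∫ y, smoothQuad g τ x y ∂μ = ∫ y, smoothQuad g τ x y ∂ν := by
    rw [(integral_smoothQuad hg hM τ x hμ3).2, (integral_smoothQuad hg hM τ x hν3).2,
      integral_norm_sq_eq_sum_inner hμ3, integral_norm_sq_eq_sum_inner hν3]
    simp only [h2]
  have a1 := abs_integral_gaussSmooth_sub_le hg hM hL hτ x hμ3
  have a2 := abs_integral_gaussSmooth_sub_le hg hM hL hτ x hν3
  rw [e1, e2] at a1
  rw [mul_add]
  rw [abs_le] at a1 a2 ⊢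
  constructor <;> linarith [a1.1, a1.2, a2.1, a2.2]

/-- The Lindeberg replacement. The Gaussian part of a partially replaced sum is absorbed in the
smoothing parameter, so that the induction over the summands runs for all parameters at once. -/
theorem abs_integral_gaussSmooth_sum_sub_le {Ω ι E : Type*} [MeasurableSpace Ω]
    [NormedAddCommGroup E] [InnerProductSpace ℝ E] [FiniteDimensional ℝ E] [MeasurableSpace E]
    [BorelSpace E] {P : Measure Ω} [IsProbabilityMeasure P] {ξ : ι → Ω → E}
    (hξ : ∀ i, Measurable (ξ i)) (hindep : iIndepFun ξ P) {s b : ℝ} (hs : 0 ≤ s)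
    (h3 : ∀ i, Integrable (fun ω => ‖ξ i ω‖ ^ 3) P)
    (hm1 : ∀ i u, ∫ ω, inner ℝ u (ξ i ω) ∂P = 0)
    (hm2 : ∀ i u, ∫ ω, inner ℝ u (ξ i ω) ^ 2 ∂P = s * ‖u‖ ^ 2)
    (hb : ∀ i, ∫ ω, ‖ξ i ω‖ ^ 3 ∂P ≤ b)
    {g : E → ℝ} {M L τ₀ : ℝ} (hg : Measurable g) (hM : ∀ z, |g z| ≤ M) (hL0 : 0 ≤ L)
    (hL : ∀ z w, |g z - g w| ≤ L * ‖z - w‖) (hτ₀ : 0 < τ₀) (A : Finset ι) {τ : ℝ} (hτ : τ₀ ≤ τ) :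
    |∫ ω, gaussSmooth g τ (∑ i ∈ A, ξ i ω) ∂P - gaussSmooth g (τ + A.card * s) 0| ≤
      A.card * (2 * L / τ₀ * (b + s * √s * ∫ z, ‖z‖ ^ 3 ∂stdGaussian E)) := by
  classical
  induction A using Finset.induction_on generalizing τ with
  | empty => simp
  | insert i A hi ih =>
    set b' : ℝ := s * √s * ∫ z, ‖z‖ ^ 3 ∂stdGaussian E with hb'
    have hτpos : 0 < τ := hτ₀.trans_le hτ
    have hSm : Measurable fun ω => ∑ j ∈ A, ξ j ω := by fun_prop
    have hFm := measurable_gaussSmooth hg τ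
    have hpξ : IsProbabilityMeasure (P.map (ξ i)) :=
      Measure.isProbabilityMeasure_map (hξ i).aemeasurable
    have hpS : IsProbabilityMeasure (P.map fun ω => ∑ j ∈ A, ξ j ω) :=
      Measure.isProbabilityMeasure_map hSm.aemeasurable
    have hpG : IsProbabilityMeasure ((stdGaussian E).map (√s • ·)) :=
      Measure.isProbabilityMeasure_map (by fun_prop)
    -- The law of the enlarged sum is a convolution.
    have hsplit : ∫ ω, gaussSmooth g τ (∑ j ∈ insert i A, ξ j ω) ∂P =
        ∫ ω, ∫ y, gaussSmooth g τ (∑ j ∈ A, ξ j ω + y) ∂(P.map (ξ i)) ∂P := by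
      have hind : IndepFun (fun ω => ∑ j ∈ A, ξ j ω) (ξ i) P := by
        have := hindep.indepFun_finsetSum_of_notMem hξ hi
        convert this using 1
        ext ω
        simp
      have hlaw := hind.map_add_eq_map_conv_map hSm (hξ i)
      have e1 : ∀ ω, ∑ j ∈ insert i A, ξ j ω = ((fun ω => ∑ j ∈ A, ξ j ω) + ξ i) ω := fun ω => by
        rw [Finset.sum_insert hi, add_comm]; rfl
      simp only [e1]
      rw [← integral_map (φ := (fun ω => ∑ j ∈ A, ξ j ω) + ξ i) (f := gaussSmooth g τ)
        (hSm.add (hξ i)).aemeasurable hFm.aestronglyMeasurable, hlaw, integral_conv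
        (integrable_of_measurable_of_abs_le hFm fun z => abs_gaussSmooth_le hM τ z),
        integral_map hSm.aemeasurable]
      have : StronglyMeasurable fun q : E × E => gaussSmooth g τ (q.1 + q.2) :=
        (hFm.comp (by fun_prop)).stronglyMeasurable
      exact (this.integral_prod_right (ν := P.map (ξ i))).aestronglyMeasurable
    have hstep : ∀ x : E, |∫ y, gaussSmooth g τ (x + y) ∂(P.map (ξ i)) -
        gaussSmooth g (τ + s) x| ≤ 2 * L / τ₀ * (b + b') := by
      intro x
      have e2 : gaussSmooth g (τ + s) x =
          ∫ y, gaussSmooth g τ (x + y) ∂((stdGaussian E).map (√s • ·)) := by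
        rw [integral_map (by fun_prop) (Measurable.aestronglyMeasurable (by fun_prop)),
          integral_gaussSmooth_add hg hM hτpos.le hs]
      have hn3 : ∀ m : Measure E, AEStronglyMeasurable (fun y : E => ‖y‖ ^ 3) m := fun m => by
        fun_prop
      have e3 : ∀ z : E, ‖√s • z‖ ^ 3 = s * √s * ‖z‖ ^ 3 := fun z => by
        rw [norm_smul, Real.norm_eq_abs, abs_of_nonneg (Real.sqrt_nonneg s)]
        nth_rewrite 2 [← Real.mul_self_sqrt hs]
        ring
      have hG3 : Integrable (fun y => ‖y‖ ^ 3) ((stdGaussian E).map (√s • ·)) := by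
        rw [integrable_map_measure (hn3 _) (by fun_prop)]
        simp only [Function.comp_def, e3]
        exact (integrable_norm_pow_stdGaussian 3).const_mul _
      have hξ3 : Integrable (fun y => ‖y‖ ^ 3) (P.map (ξ i)) := by
        rw [integrable_map_measure (hn3 _) (hξ i).aemeasurable]
        exact h3 i
      have hbase := abs_integral_gaussSmooth_sub_integral_le hg hM hL hτpos x hξ3 hG3
        (fun u => by
          rw [integral_map (hξ i).aemeasurable (by fun_prop),
            integral_map (by fun_prop) (by fun_prop), hm1]
          simp [real_inner_smul_right, integral_const_mul, integral_inner_stdGaussian])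
        (fun u => by
          rw [integral_map (hξ i).aemeasurable (by fun_prop),
            integral_map (by fun_prop) (by fun_prop), hm2]
          simp only [real_inner_smul_right, mul_pow, integral_const_mul,
            integral_inner_sq_stdGaussian, Real.sq_sqrt hs])
      rw [← e2, integral_map (hξ i).aemeasurable (hn3 _),
        integral_map (by fun_prop) (hn3 _)] at hbase
      simp only [e3, integral_const_mul] at hbase
      refine hbase.trans ?_
      have hb0 : 0 ≤ ∫ ω, ‖ξ i ω‖ ^ 3 ∂P := integral_nonneg fun ω => by positivity
      have hb'0 : 0 ≤ b' := mul_nonneg (by positivity) (integral_nonneg fun z => by positivity)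
      have h1 : 2 * L / τ ≤ 2 * L / τ₀ := by gcongr
      have h2 : ∫ ω, ‖ξ i ω‖ ^ 3 ∂P + b' ≤ b + b' := by linarith [hb i]
      exact mul_le_mul h1 h2 (by linarith) (by positivity)
    have hIH := ih (τ := τ + s) (by linarith)
    have hcard : τ + s + (A.card : ℝ) * s = τ + ((insert i A).card : ℝ) * s := by
      rw [Finset.card_insert_of_notMem hi]; push_cast; ring
    rw [hcard] at hIH
    have hFs := measurable_gaussSmooth hg (τ + s)
    have hm' : StronglyMeasurable fun q : E × E => gaussSmooth g τ (q.1 + q.2) :=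
      (hFm.comp (by fun_prop)).stronglyMeasurable
    have hm'' := (hm'.integral_prod_right' (ν := P.map (ξ i))).measurable
    have hdiff : |∫ ω, gaussSmooth g τ (∑ j ∈ insert i A, ξ j ω) ∂P -
        ∫ ω, gaussSmooth g (τ + s) (∑ j ∈ A, ξ j ω) ∂P| ≤ 2 * L / τ₀ * (b + b') := by
      rw [hsplit, ← integral_sub, ← Real.norm_eq_abs]
      · exact (norm_integral_le_of_norm_le_const (C := 2 * L / τ₀ * (b + b'))
          (ae_of_all _ fun ω => hstep (∑ j ∈ A, ξ j ω))).trans_eq (by simp)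
      · refine integrable_of_measurable_of_abs_le (M := M) (hm''.comp hSm) fun ω => ?_
        have := norm_integral_le_of_norm_le_const (μ := P.map (ξ i)) (C := M)
          (f := fun y => gaussSmooth g τ (∑ j ∈ A, ξ j ω + y))
          (ae_of_all _ fun y => abs_gaussSmooth_le hM τ _)
        simpa using this
      · exact integrable_of_measurable_of_abs_le (hFs.comp hSm) fun ω => abs_gaussSmooth_le hM _ _
    rw [Finset.card_insert_of_notMem hi] at hIH ⊢
    push_cast at hIH ⊢
    rw [abs_le] at hIH hdiff ⊢
    constructor <;> linarith [hIH.1, hIH.2, hdiff.1, hdiff.2]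

/-! ### Yurinskii's coupling -/

/-- A Lipschitz function with values in `[0, 1]` that is `1` within distance `δ` of `A` and `0` at
distance at least `2 δ` from `A`. -/
noncomputable def cutoff {E : Type*} [PseudoMetricSpace E] (A : Set E) (δ : ℝ) (x : E) : ℝ :=
  max 0 (min 1 (2 - Metric.infDist x A / δ))

lemma cutoff_nonneg {E : Type*} [PseudoMetricSpace E] (A : Set E) (δ : ℝ) (x : E) :
    0 ≤ cutoff A δ x := le_max_left _ _

lemma cutoff_le_one {E : Type*} [PseudoMetricSpace E] (A : Set E) (δ : ℝ) (x : E) :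
    cutoff A δ x ≤ 1 := max_le zero_le_one (min_le_left _ _)

lemma abs_cutoff_le_one {E : Type*} [PseudoMetricSpace E] (A : Set E) (δ : ℝ) (x : E) :
    |cutoff A δ x| ≤ 1 := by
  rw [abs_of_nonneg (cutoff_nonneg A δ x)]
  exact cutoff_le_one A δ x

lemma cutoff_eq_one {E : Type*} [PseudoMetricSpace E] {A : Set E} {δ : ℝ} (hδ : 0 < δ) {x : E}
    (hx : Metric.infDist x A ≤ δ) : cutoff A δ x = 1 := by
  have : Metric.infDist x A / δ ≤ 1 := (div_le_one hδ).2 hx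
  rw [cutoff, min_eq_left (by linarith), max_eq_right zero_le_one]

lemma cutoff_eq_zero {E : Type*} [PseudoMetricSpace E] {A : Set E} {δ : ℝ} (hδ : 0 < δ) {x : E}
    (hx : 2 * δ ≤ Metric.infDist x A) : cutoff A δ x = 0 := by
  have : 2 ≤ Metric.infDist x A / δ := (le_div_iff₀ hδ).2 hx
  exact max_eq_left ((min_le_right _ _).trans (by linarith))

lemma abs_cutoff_sub_le {E : Type*} [SeminormedAddCommGroup E] (A : Set E) {δ : ℝ} (hδ : 0 < δ)
    (x y : E) : |cutoff A δ x - cutoff A δ y| ≤ δ⁻¹ * ‖x - y‖ := by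
  have h1 : |cutoff A δ x - cutoff A δ y| ≤
      |min 1 (2 - Metric.infDist x A / δ) - min 1 (2 - Metric.infDist y A / δ)| :=
    (abs_max_sub_max_le_max _ _ _ _).trans (max_le (by simp) le_rfl)
  have h2 : |min 1 (2 - Metric.infDist x A / δ) - min 1 (2 - Metric.infDist y A / δ)| ≤
      |(2 - Metric.infDist x A / δ) - (2 - Metric.infDist y A / δ)| :=
    (abs_min_sub_min_le_max _ _ _ _).trans (max_le (by simp) le_rfl)
  refine h1.trans (h2.trans ?_)
  have h3 := (Metric.lipschitz_infDist_pt A).dist_le_mul y x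
  rw [Real.dist_eq, NNReal.coe_one, one_mul, dist_comm, dist_eq_norm] at h3
  have h4 : 2 - Metric.infDist x A / δ - (2 - Metric.infDist y A / δ) =
      δ⁻¹ * (Metric.infDist y A - Metric.infDist x A) := by ring
  rw [h4, abs_mul, abs_of_pos (inv_pos.2 hδ)]
  gcongr

lemma measurable_cutoff {E : Type*} [PseudoMetricSpace E] [MeasurableSpace E]
    [OpensMeasurableSpace E] (A : Set E) (δ : ℝ) : Measurable (cutoff A δ) := by
  have := Metric.continuous_infDist_pt A
  have : Continuous (cutoff A δ) := by
    unfold cutoff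
    fun_prop
  exact this.measurable

lemma stdGaussian_norm_ge_le {k : ℕ} (hk : 0 < k) {δ t : ℝ} (hδ : 0 < δ) (ht : 0 < t) :
    (stdGaussian (Vec k)).real {z | δ ≤ √(δ ^ 2 / (t * k)) * ‖z‖} ≤ 1 / t := by
  have hk' : (0 : ℝ) < k := by exact_mod_cast hk
  have hsub : {z : Vec k | δ ≤ √(δ ^ 2 / (t * k)) * ‖z‖} ⊆ {z | t * k ≤ ‖z‖ ^ 2} := by
    intro z hz
    have h1 : δ ^ 2 ≤ (√(δ ^ 2 / (t * k)) * ‖z‖) ^ 2 := pow_le_pow_left₀ hδ.le hz 2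
    rw [mul_pow, Real.sq_sqrt (by positivity), div_mul_eq_mul_div,
      le_div_iff₀ (by positivity)] at h1
    exact le_of_mul_le_mul_left h1 (by positivity)
  have h2 := mul_meas_ge_le_integral_of_nonneg (μ := stdGaussian (Vec k))
    (f := fun z => ‖z‖ ^ 2) (ae_of_all _ fun z => by positivity)
    (integrable_norm_pow_stdGaussian 2) (t * k)
  rw [integral_norm_sq_stdGaussian] at h2
  refine (measureReal_mono hsub).trans ?_
  rw [le_div_iff₀ ht]
  have h3 : t * (stdGaussian (Vec k)).real {z | t * k ≤ ‖z‖ ^ 2} * k ≤ 1 * k := by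
    rw [mul_right_comm, one_mul]; exact h2
  have := le_of_mul_le_mul_right h3 hk'
  linarith

lemma one_sub_le_gaussSmooth_cutoff {k : ℕ} (hk : 0 < k) {δ t : ℝ} (hδ : 0 < δ) (ht : 0 < t)
    {A : Set (Vec k)} {x : Vec k} (hx : x ∈ A) :
    1 - 1 / t ≤ gaussSmooth (cutoff A δ) (δ ^ 2 / (t * k)) x := by
  set τ := δ ^ 2 / (t * k) with hτ
  set D : Set (Vec k) := {z | δ ≤ √τ * ‖z‖} with hD
  have hDm : MeasurableSet D := measurableSet_le measurable_const (by fun_prop)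
  have hpt : ∀ z : Vec k, 1 - D.indicator 1 z ≤ cutoff A δ (x + √τ • z) := by
    intro z
    by_cases hz : z ∈ D
    · simp [hz, cutoff_nonneg]
    · have hz' : √τ * ‖z‖ < δ := not_le.1 hz
      rw [cutoff_eq_one hδ]
      · simp [hz]
      · refine (Metric.infDist_le_dist_of_mem hx).trans ?_
        rw [dist_self_add_left, norm_smul, Real.norm_eq_abs, abs_of_nonneg (Real.sqrt_nonneg _)]
        exact hz'.le
  have hi1 : Integrable (D.indicator (1 : Vec k → ℝ)) (stdGaussian (Vec k)) :=
    (integrable_const (1 : ℝ)).indicator hDm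
  have hi2 : Integrable (fun z => cutoff A δ (x + √τ • z)) (stdGaussian (Vec k)) :=
    integrable_of_measurable_of_abs_le ((measurable_cutoff A δ).comp (by fun_prop))
      fun z => abs_cutoff_le_one A δ _
  have := integral_mono ((integrable_const 1).sub hi1) hi2 hpt
  simp only [Pi.sub_apply] at this
  rw [integral_sub (integrable_const 1) hi1, integral_indicator_one hDm] at this
  have h2 := stdGaussian_norm_ge_le hk hδ ht
  rw [gaussSmooth]
  simp only [integral_const, probReal_univ, one_smul] at this
  linarith

lemma gaussSmooth_cutoff_le {k : ℕ} (hk : 0 < k) {δ t : ℝ} (hδ : 0 < δ) (ht : 0 < t)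
    {A : Set (Vec k)} {x : Vec k} (hx : 3 * δ ≤ Metric.infDist x A) :
    gaussSmooth (cutoff A δ) (δ ^ 2 / (t * k)) x ≤ 1 / t := by
  set τ := δ ^ 2 / (t * k) with hτ
  set D : Set (Vec k) := {z | δ ≤ √τ * ‖z‖} with hD
  have hDm : MeasurableSet D := measurableSet_le measurable_const (by fun_prop)
  have hpt : ∀ z : Vec k, cutoff A δ (x + √τ • z) ≤ D.indicator 1 z := by
    intro z
    by_cases hz : z ∈ D
    · simp [hz, cutoff_le_one]
    · have hz' : √τ * ‖z‖ < δ := not_le.1 hz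
      rw [cutoff_eq_zero hδ]
      · simp [hz]
      · have h1 := Metric.infDist_le_infDist_add_dist (s := A) (x := x) (y := x + √τ • z)
        rw [dist_self_add_right, norm_smul, Real.norm_eq_abs,
          abs_of_nonneg (Real.sqrt_nonneg _)] at h1
        linarith
  have hi1 : Integrable (D.indicator (1 : Vec k → ℝ)) (stdGaussian (Vec k)) :=
    (integrable_const (1 : ℝ)).indicator hDm
  have hi2 : Integrable (fun z => cutoff A δ (x + √τ • z)) (stdGaussian (Vec k)) :=
    integrable_of_measurable_of_abs_le ((measurable_cutoff A δ).comp (by fun_prop))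
      fun z => abs_cutoff_le_one A δ _
  have := integral_mono hi2 hi1 hpt
  rw [integral_indicator_one hDm] at this
  exact this.trans (stdGaussian_norm_ge_le hk hδ ht)

/-- Lyapunov's inequality between the second and third moments, from
`y³ - (3/2) c y² + c³ / 2 = (y - c)² (y + c / 2)`. -/
lemma mul_sqrt_integral_sq_le_integral_pow_three {Ω : Type*} [MeasurableSpace Ω] {P : Measure Ω}
    [IsProbabilityMeasure P] {f : Ω → ℝ} (hf : ∀ ω, 0 ≤ f ω) (h2 : Integrable (fun ω => f ω ^ 2) P)
    (h3 : Integrable (fun ω => f ω ^ 3) P) :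
    (∫ ω, f ω ^ 2 ∂P) * √(∫ ω, f ω ^ 2 ∂P) ≤ ∫ ω, f ω ^ 3 ∂P := by
  set c := √(∫ ω, f ω ^ 2 ∂P) with hc
  have hc0 : 0 ≤ c := Real.sqrt_nonneg _
  have hcc : c ^ 2 = ∫ ω, f ω ^ 2 ∂P := Real.sq_sqrt (integral_nonneg fun ω => sq_nonneg _)
  have hpt : ∀ ω, 3 / 2 * c * f ω ^ 2 - c ^ 3 / 2 ≤ f ω ^ 3 := by
    intro ω
    have : 0 ≤ (f ω - c) ^ 2 * (f ω + c / 2) := by have := hf ω; positivity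
    nlinarith
  have := integral_mono ((h2.const_mul (3 / 2 * c)).sub (integrable_const (c ^ 3 / 2))) h3 hpt
  simp only [Pi.sub_apply] at this
  rw [integral_sub (h2.const_mul _) (integrable_const _), integral_const_mul, ← hcc,
    integral_const, probReal_univ, one_smul] at this
  rw [← hcc]
  linarith

/-- The constant in Yurinskii's inequality. -/
noncomputable def yurinskiiConst : ℝ := 2 * (2 + gaussFourth)

/-- The comparison of the law of a standardized sum with the Gaussian law on a set and its
neighborhood, by smoothing of the indicator and Lindeberg replacement. The third moments of the
Gaussian summands are absorbed in `b` by Lyapunov's inequality. -/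
theorem yurinskii_inequality {Ω : Type*} [MeasurableSpace Ω] {P : Measure Ω}
    [IsProbabilityMeasure P] {k n : ℕ} (hk : 0 < k) (hn : 0 < n) {ξ : Fin n → Ω → Vec k}
    (hξ : ∀ i, Measurable (ξ i)) (hindep : iIndepFun ξ P) {b : ℝ}
    (h3 : ∀ i, Integrable (fun ω => ‖ξ i ω‖ ^ 3) P)
    (hm1 : ∀ i u, ∫ ω, inner ℝ u (ξ i ω) ∂P = 0)
    (hm2 : ∀ i u, ∫ ω, inner ℝ u (ξ i ω) ^ 2 ∂P = (n : ℝ)⁻¹ * ‖u‖ ^ 2)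
    (hb : ∀ i, ∫ ω, ‖ξ i ω‖ ^ 3 ∂P ≤ b) {δ t : ℝ} (hδ : 0 < δ) (ht : 0 < t)
    {A : Set (Vec k)} (hA : MeasurableSet A) (hne : A.Nonempty) :
    (P.map fun ω => ∑ i, ξ i ω).real A ≤ (stdGaussian (Vec k)).real (Metric.thickening (3 * δ) A) +
      (2 / t + yurinskiiConst * (t * (k * n * b) / δ ^ 3)) := by
  set s : ℝ := (n : ℝ)⁻¹ with hs
  have hn' : (0 : ℝ) < n := by exact_mod_cast hn
  have hk' : (0 : ℝ) < k := by exact_mod_cast hk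
  have hs0 : 0 < s := inv_pos.2 hn'
  set τ : ℝ := δ ^ 2 / (t * k) with hτ
  have hτ0 : 0 < τ := by positivity
  set f := gaussSmooth (cutoff A δ) τ with hf
  have hgm := measurable_cutoff A δ
  have hgb := abs_cutoff_le_one A δ
  have hfm : Measurable f := measurable_gaussSmooth hgm τ
  have hfb : ∀ x, |f x| ≤ 1 := abs_gaussSmooth_le hgb τ
  have hSm : Measurable fun ω => ∑ i, ξ i ω := by fun_prop
  have hf0 : ∀ x, 0 ≤ f x := fun x => integral_nonneg fun z => cutoff_nonneg _ _ _
  -- The replacement of the sum by a Gaussian vector.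
  have hlind := abs_integral_gaussSmooth_sum_sub_le hξ hindep hs0.le h3 hm1 hm2 hb hgm hgb
    (inv_pos.2 hδ).le (abs_cutoff_sub_le A hδ) hτ0 Finset.univ le_rfl
  have hns : (n : ℝ) * s = 1 := mul_inv_cancel₀ hn'.ne'
  rw [Finset.card_univ, Fintype.card_fin, hns] at hlind
  have hgauss : ∫ z, f z ∂stdGaussian (Vec k) = gaussSmooth (cutoff A δ) (τ + 1) 0 := by
    rw [← integral_gaussSmooth_add hgm hgb hτ0.le zero_le_one]
    simp [hf]
  rw [← hgauss] at hlind
  -- The Gaussian summands have third moments of at most the same order.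
  have hm3 : s * √s * ∫ z, ‖z‖ ^ 3 ∂stdGaussian (Vec k) ≤ (1 + gaussFourth) * b := by
    have hsq : ∫ ω, ‖ξ ⟨0, hn⟩ ω‖ ^ 2 ∂P = s * k := by
      have hlaw3 : Integrable (fun y => ‖y‖ ^ 3) (P.map (ξ ⟨0, hn⟩)) := by
        rw [integrable_map_measure (by fun_prop) (hξ _).aemeasurable]
        exact h3 _
      have := integral_norm_sq_eq_sum_inner hlaw3
      rw [integral_map (hξ _).aemeasurable (by fun_prop)] at this
      rw [this]
      have : ∀ u : Vec k, ∫ y, inner ℝ u y ^ 2 ∂(P.map (ξ ⟨0, hn⟩)) = s * ‖u‖ ^ 2 := fun u => by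
        rw [integral_map (hξ _).aemeasurable (by fun_prop), hm2]
      simp [this, mul_comm]
    have hly := mul_sqrt_integral_sq_le_integral_pow_three (P := P)
      (f := fun ω => ‖ξ ⟨0, hn⟩ ω‖) (fun ω => norm_nonneg _)
      (integrable_norm_pow_of_le_three (hξ _) (h3 _) (by norm_num)) (h3 _)
    rw [hsq, Real.sqrt_mul hs0.le] at hly
    have h1 := hly.trans (hb _)
    have h2 := integral_norm_pow_three_stdGaussian_le k
    have h4 := gaussFourth_nonneg
    calc s * √s * ∫ z, ‖z‖ ^ 3 ∂stdGaussian (Vec k)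
        ≤ s * √s * ((1 + gaussFourth) * (k * √k)) := by gcongr
      _ = (1 + gaussFourth) * (s * k * (√s * √k)) := by ring
      _ ≤ (1 + gaussFourth) * b := by gcongr
  have herr : (n : ℝ) * (2 * δ⁻¹ / τ * (b + s * √s * ∫ z, ‖z‖ ^ 3 ∂stdGaussian (Vec k))) ≤
      yurinskiiConst * (t * (k * n * b) / δ ^ 3) := by
    calc (n : ℝ) * (2 * δ⁻¹ / τ * (b + s * √s * ∫ z, ‖z‖ ^ 3 ∂stdGaussian (Vec k)))
        ≤ (n : ℝ) * (2 * δ⁻¹ / τ * (b + (1 + gaussFourth) * b)) := by gcongr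
      _ = yurinskiiConst * (t * (k * n * b) / δ ^ 3) := by
        rw [hτ, yurinskiiConst]
        field_simp
        ring
  have hlow : (P.map fun ω => ∑ i, ξ i ω).real A - 1 / t ≤ ∫ ω, f (∑ i, ξ i ω) ∂P := by
    have hp : IsProbabilityMeasure (P.map fun ω => ∑ i, ξ i ω) :=
      Measure.isProbabilityMeasure_map hSm.aemeasurable
    rw [← integral_map (φ := fun ω => ∑ i, ξ i ω) (f := f) hSm.aemeasurable
      hfm.aestronglyMeasurable]
    have hiA : Integrable (A.indicator (1 : Vec k → ℝ)) (P.map fun ω => ∑ i, ξ i ω) :=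
      (integrable_const (1 : ℝ)).indicator hA
    have := integral_mono (hiA.sub (integrable_const (1 / t)))
      (integrable_of_measurable_of_abs_le hfm hfb) (fun x => by
        by_cases hx : x ∈ A
        · simpa [hx] using one_sub_le_gaussSmooth_cutoff hk hδ ht hx
        · have : 0 < t⁻¹ := inv_pos.2 ht
          simp [hx]
          linarith [hf0 x])
    simp only [Pi.sub_apply] at this
    rw [integral_sub hiA (integrable_const _), integral_indicator_one hA, integral_const,
      probReal_univ, one_smul] at this
    exact this
  have hup : ∫ z, f z ∂stdGaussian (Vec k) ≤
      (stdGaussian (Vec k)).real (Metric.thickening (3 * δ) A) + 1 / t := by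
    have hTm : MeasurableSet (Metric.thickening (3 * δ) A) := Metric.isOpen_thickening.measurableSet
    have hiT : Integrable ((Metric.thickening (3 * δ) A).indicator (1 : Vec k → ℝ))
        (stdGaussian (Vec k)) := (integrable_const (1 : ℝ)).indicator hTm
    have := integral_mono (integrable_of_measurable_of_abs_le (μ := stdGaussian (Vec k)) hfm hfb)
      (hiT.add (integrable_const (1 / t))) (fun x => by
        by_cases hx : x ∈ Metric.thickening (3 * δ) A
        · have h1 := (abs_le.1 (hfb x)).2
          have : 0 < t⁻¹ := inv_pos.2 ht
          simp [hx]
          linarith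
        · have : 3 * δ ≤ Metric.infDist x A := by
            by_contra hlt
            obtain ⟨y, hy, hxy⟩ := (Metric.infDist_lt_iff hne).1 (not_le.1 hlt)
            exact hx (Metric.mem_thickening_iff.2 ⟨y, hy, hxy⟩)
          simpa [hx] using gaussSmooth_cutoff_le hk hδ ht this)
    simp only [Pi.add_apply] at this
    rw [integral_add hiT (integrable_const _), integral_indicator_one hTm, integral_const,
      probReal_univ, one_smul] at this
    exact this
  have h2t : 2 / t = 1 / t + 1 / t := by ring
  have := (abs_le.1 hlind).2
  linarith

/-- Yurinskii's coupling, on the probability space enlarged by a uniform variable. -/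
theorem exists_yurinskii_coupling {Ω : Type*} [MeasurableSpace Ω] {P : Measure Ω}
    [IsProbabilityMeasure P] {k n : ℕ} (hk : 0 < k) (hn : 0 < n) {ξ : Fin n → Ω → Vec k}
    (hξ : ∀ i, Measurable (ξ i)) (hindep : iIndepFun ξ P) {b : ℝ}
    (h3 : ∀ i, Integrable (fun ω => ‖ξ i ω‖ ^ 3) P)
    (hm1 : ∀ i u, ∫ ω, inner ℝ u (ξ i ω) ∂P = 0)
    (hm2 : ∀ i u, ∫ ω, inner ℝ u (ξ i ω) ^ 2 ∂P = (n : ℝ)⁻¹ * ‖u‖ ^ 2)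
    (hb : ∀ i, ∫ ω, ‖ξ i ω‖ ^ 3 ∂P ≤ b) {δ t η : ℝ} (hδ : 0 < δ) (ht : 0 < t) (hη : 0 < η) :
    ∃ N : Ω × unitInterval → Vec k, HasLaw N (stdGaussian (Vec k)) (P.prod volume) ∧
      (P.prod volume) {ω | 3 * δ + η ≤ ‖∑ i, ξ i ω.1 - N ω‖} ≤
        ENNReal.ofReal (2 / t + yurinskiiConst * (t * (k * n * b) / δ ^ 3) + η) := by
  have hSm : Measurable fun ω => ∑ i, ξ i ω := by fun_prop
  have hp : IsProbabilityMeasure (P.map fun ω => ∑ i, ξ i ω) :=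
    Measure.isProbabilityMeasure_map hSm.aemeasurable
  have hb0 : 0 ≤ b := (integral_nonneg fun ω => by positivity).trans (hb ⟨0, hn⟩)
  have hC : 0 ≤ yurinskiiConst := by
    have := gaussFourth_nonneg
    unfold yurinskiiConst
    linarith
  obtain ⟨π, hπ1, hπ2, hπ⟩ := exists_coupling_of_le_thickening
    (P.map fun ω => ∑ i, ξ i ω) (stdGaussian (Vec k))
    (fun A hA hne => yurinskii_inequality hk hn hξ hindep h3 hm1 hm2 hb hδ ht hA hne)
    (by positivity) hη
  obtain ⟨N, hN, hlaw⟩ := exists_realization_of_coupling P hSm π hπ1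
  have hm : Measurable fun z : Ω × unitInterval => (∑ i, ξ i z.1, N z) :=
    (hSm.comp measurable_fst).prodMk hN
  refine ⟨N, ⟨hN.aemeasurable, ?_⟩, ?_⟩
  · rw [← hπ2, ← hlaw, Measure.map_map measurable_snd hm]
    rfl
  · rw [← hlaw, Measure.map_apply hm (measurableSet_le measurable_const (by fun_prop))] at hπ
    simpa only [dist_eq_norm, Set.preimage_ofPred_eq] using hπ

/-! ### The normalized score -/

lemma mulVecE_eq_toEuclideanCLM {k : ℕ} (M : Matrix (Fin k) (Fin k) ℝ) (x : Vec k) :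
    mulVecE M x = Matrix.toEuclideanCLM (𝕜 := ℝ) M x := rfl

lemma inner_eq_dotProduct {k : ℕ} (x y : Vec k) : inner ℝ x y = x.ofLp ⬝ᵥ y.ofLp := by
  rw [EuclideanSpace.inner_eq_star_dotProduct, dotProduct_comm]
  simp

lemma inner_mulVecE {k : ℕ} (M : Matrix (Fin k) (Fin k) ℝ) (u x : Vec k) :
    inner ℝ u (mulVecE M x) = inner ℝ (vecMulE u M) x := by
  rw [inner_eq_dotProduct, inner_eq_dotProduct]
  exact Matrix.dotProduct_mulVec u.ofLp M x.ofLp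

lemma inner_vecMulE_vecMulE {k : ℕ} (M S : Matrix (Fin k) (Fin k) ℝ) (u : Vec k) :
    (vecMulE u M).ofLp ⬝ᵥ S.mulVec (vecMulE u M).ofLp =
      u.ofLp ⬝ᵥ (M * S * M.transpose).mulVec u.ofLp := by
  simp only [vecMulE]
  rw [← Matrix.mulVec_mulVec, ← Matrix.mulVec_mulVec, Matrix.mulVec_transpose,
    Matrix.dotProduct_mulVec (WithLp.ofLp u) M]

lemma norm_mulVecE_sq {k : ℕ} (M : Matrix (Fin k) (Fin k) ℝ) (x : Vec k) :
    ‖mulVecE M x‖ ^ 2 = x.ofLp ⬝ᵥ (M.transpose * M).mulVec x.ofLp := by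
  rw [← real_inner_self_eq_norm_sq, inner_eq_dotProduct]
  simp only [mulVecE]
  rw [← Matrix.mulVec_mulVec, Matrix.dotProduct_mulVec x.ofLp, Matrix.vecMul_transpose]

lemma dotProduct_mulVec_le_of_eigenvalue_le {k : ℕ} {M : Matrix (Fin k) (Fin k) ℝ}
    (hM : M.IsHermitian) {s : ℝ}
    (hs : ∀ μ, Module.End.HasEigenvalue (Matrix.toLin' M) μ → μ ≤ s) (x : Fin k → ℝ) :
    x ⬝ᵥ M.mulVec x ≤ s * (x ⬝ᵥ x) := by
  have hN : (s • (1 : Matrix (Fin k) (Fin k) ℝ) - M).IsHermitian := by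
    refine Matrix.IsHermitian.sub ?_ hM
    rw [Matrix.IsHermitian, Matrix.conjTranspose_smul, Matrix.conjTranspose_one]
    simp
  have hpsd : (s • (1 : Matrix (Fin k) (Fin k) ℝ) - M).PosSemidef := by
    rw [hN.posSemidef_iff_eigenvalues_nonneg]
    intro i
    have hv := hN.mulVec_eigenvectorBasis i
    set v := (hN.eigenvectorBasis i).ofLp with hvdef
    have hv0 : v ≠ 0 := by
      intro h0
      have h1 := hN.eigenvectorBasis.orthonormal.1 i
      have : hN.eigenvectorBasis i = 0 := by
        ext j
        exact congrFun h0 j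
      rw [this, norm_zero] at h1
      exact zero_ne_one h1
    have hev : M.mulVec v = (s - hN.eigenvalues i) • v := by
      rw [Matrix.sub_mulVec, Matrix.smul_mulVec, Matrix.one_mulVec] at hv
      rw [sub_smul, ← hv]
      abel
    have := hs (s - hN.eigenvalues i) (Module.End.hasEigenvalue_of_hasEigenvector (x := v)
      ⟨Module.End.mem_eigenspace_iff.2 (by rw [Matrix.toLin'_apply, hev]), hv0⟩)
    simp only [Pi.zero_apply]
    linarith
  have := (Matrix.posSemidef_iff_dotProduct_mulVec.1 hpsd).2 x
  rw [Matrix.sub_mulVec, Matrix.smul_mulVec, Matrix.one_mulVec, dotProduct_sub,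
    dotProduct_smul] at this
  simp only [star_trivial, smul_eq_mul] at this
  linarith

lemma sandwich_posDef {k : ℕ} {Q S : Matrix (Fin k) (Fin k) ℝ} (hS : S.PosSemidef)
    (hSdet : IsUnit S.det) (hQ : IsUnit Q.det) : (sandwich Q S).PosDef := by
  have h1 : (sandwich Q S).PosSemidef := by
    have := hS.mul_mul_conjTranspose_same Q⁻¹
    rwa [Matrix.conjTranspose_eq_transpose_of_trivial] at this
  rw [h1.posDef_iff_isUnit, Matrix.isUnit_iff_isUnit_det, sandwich, Matrix.det_mul, Matrix.det_mul,
    Matrix.det_transpose]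
  have := Matrix.isUnit_nonsing_inv_det Q hQ
  exact (this.mul hSdet).mul this

lemma rootM_spec {k : ℕ} {W : Matrix (Fin k) (Fin k) ℝ} (hW : W.PosDef) :
    (rootM W).transpose = rootM W ∧ rootM W * rootM W = W ∧ IsUnit (rootM W).det := by
  obtain ⟨h1, h2⟩ := (rootM_eq_iff hW.posSemidef).1 rfl
  refine ⟨?_, h2, ?_⟩
  · have := h1.isHermitian.eq
    rwa [Matrix.conjTranspose_eq_transpose_of_trivial] at this
  · have h3 := (Matrix.isUnit_iff_isUnit_det _).1 hW.isUnit
    rw [← h2, Matrix.det_mul] at h3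
    exact isUnit_of_mul_isUnit_left h3

/-- The matrix `W^{-1/2} Q⁻¹` standardizes the covariance `S`. -/
lemma whitening_mul_mul_transpose {k : ℕ} {Q S : Matrix (Fin k) (Fin k) ℝ} (hS : S.PosSemidef)
    (hSdet : IsUnit S.det) (hQ : IsUnit Q.det) :
    (invRootM (sandwich Q S) * Q⁻¹) * S * (invRootM (sandwich Q S) * Q⁻¹).transpose = 1 := by
  obtain ⟨h1, h2, h3⟩ := rootM_spec (sandwich_posDef hS hSdet hQ)
  set R := rootM (sandwich Q S) with hR
  have e : (R⁻¹ * Q⁻¹) * S * (R⁻¹ * Q⁻¹).transpose = R⁻¹ * sandwich Q S * R⁻¹ := by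
    rw [Matrix.transpose_mul, Matrix.transpose_nonsing_inv R, h1, sandwich]
    simp only [Matrix.mul_assoc]
  rw [invRootM, ← hR, e, ← h2, ← Matrix.mul_assoc, Matrix.nonsing_inv_mul _ h3, Matrix.one_mul,
    Matrix.mul_nonsing_inv _ h3]

lemma transpose_whitening_mul {k : ℕ} {T S : Matrix (Fin k) (Fin k) ℝ}
    (h : T * S * T.transpose = 1) : T.transpose * T = S⁻¹ := by
  rw [Matrix.mul_assoc, mul_eq_one_comm, Matrix.mul_assoc] at h
  exact (Matrix.inv_eq_right_inv h).symm

lemma inner_vecMulE_rootM_mulVecE_invRootM {k : ℕ} {W : Matrix (Fin k) (Fin k) ℝ} (hW : W.PosDef)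
    (p x : Vec k) :
    inner ℝ (vecMulE p (rootM W)) (mulVecE (invRootM W) x) = inner ℝ p x := by
  obtain ⟨-, -, h3⟩ := rootM_spec hW
  rw [← inner_mulVecE, mulVecE, mulVecE, invRootM, Matrix.mulVec_mulVec,
    Matrix.mul_nonsing_inv _ h3, Matrix.one_mulVec]

lemma norm_le_of_forall_abs_le {k : ℕ} {x : Vec k} {C : ℝ} (hC : 0 ≤ C) (h : ∀ j, |x j| ≤ C) :
    ‖x‖ ≤ √k * C := by
  rw [EuclideanSpace.norm_eq]
  calc √(∑ i, ‖x i‖ ^ 2) ≤ √(∑ _i : Fin k, C ^ 2) := by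
        refine Real.sqrt_le_sqrt (Finset.sum_le_sum fun i _ => ?_)
        exact pow_le_pow_left₀ (norm_nonneg _) (h i) 2
    _ = √k * C := by
        rw [Finset.sum_const, Finset.card_univ, Fintype.card_fin, nsmul_eq_mul,
          Real.sqrt_mul (by positivity), Real.sqrt_sq hC]

/-- The quadratic form of `E[ε² p(V) p(V)']`. -/
lemma dotProduct_scoreCov_mulVec {Ω X : Type*} [MeasurableSpace Ω] {k : ℕ} {P : Measure Ω}
    {p : X → Vec k} {V : Ω → X} {ε : Ω → ℝ}
    (hint : ∀ j l, Integrable (fun ω => ε ω ^ 2 * p (V ω) j * p (V ω) l) P) (x : Vec k) :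
    x.ofLp ⬝ᵥ (scoreCov P p V ε).mulVec x.ofLp = ∫ ω, ε ω ^ 2 * inner ℝ x (p (V ω)) ^ 2 ∂P := by
  have h1 : ∀ ω, ε ω ^ 2 * inner ℝ x (p (V ω)) ^ 2 =
      ∑ j, ∑ l, x j * x l * (ε ω ^ 2 * p (V ω) j * p (V ω) l) := by
    intro ω
    rw [inner_eq_dotProduct, dotProduct, sq (∑ i, _), Finset.sum_mul_sum, Finset.mul_sum]
    refine Finset.sum_congr rfl fun j _ => ?_
    rw [Finset.mul_sum]
    refine Finset.sum_congr rfl fun l _ => ?_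
    ring
  simp only [h1]
  rw [integral_finsetSum _ fun j _ => integrable_finsetSum _ fun l _ => (hint j l).const_mul _]
  simp only [dotProduct, Matrix.mulVec, Finset.mul_sum]
  refine Finset.sum_congr rfl fun j _ => ?_
  rw [integral_finsetSum _ fun l _ => (hint j l).const_mul _]
  refine Finset.sum_congr rfl fun l _ => ?_
  rw [integral_const_mul, scoreCov, Matrix.of_apply]
  ring

lemma scoreCov_posSemidef {Ω X : Type*} [MeasurableSpace Ω] {k : ℕ} {P : Measure Ω}
    {p : X → Vec k} {V : Ω → X} {ε : Ω → ℝ}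
    (hint : ∀ j l, Integrable (fun ω => ε ω ^ 2 * p (V ω) j * p (V ω) l) P) :
    (scoreCov P p V ε).PosSemidef := by
  rw [Matrix.posSemidef_iff_dotProduct_mulVec]
  refine ⟨?_, fun x => ?_⟩
  · ext j l
    simp only [scoreCov, Matrix.conjTranspose_apply, Matrix.of_apply, star_trivial]
    exact integral_congr_ae (ae_of_all _ fun ω => by ring)
  · have := dotProduct_scoreCov_mulVec hint (WithLp.toLp 2 x)
    simp only [star_trivial]
    rw [this]
    exact integral_nonneg fun ω => by positivity

/-- Yurinskii's coupling for the standardized score. The third moment of a summand is bounded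
through `‖T x‖ ≤ √s ‖x‖` for `T = W^{-1/2} Q⁻¹`, which holds because `T' T = S⁻¹`. -/
theorem exists_score_coupling {Ω X : Type*} [MeasurableSpace Ω] [MeasurableSpace X] {P : Measure Ω}
    [IsProbabilityMeasure P] {k n : ℕ} (hk : 0 < k) (hn : 0 < n) {p : X → Vec k}
    (hp : Measurable p) {V : Fin n → Ω → X} {ε : Fin n → Ω → ℝ}
    (hVm : ∀ i, Measurable (V i)) (hεm : ∀ i, Measurable (ε i))
    (hindep : iIndepFun (fun i ω => (V i ω, ε i ω)) P) (hε3 : ∀ i, MemLp (ε i) 3 P)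
    {C₃ Cp : ℝ} (hC₃ : ∀ i, ∫ ω, |ε i ω| ^ 3 ∂P ≤ C₃) (hCp0 : 0 ≤ Cp)
    (hCp : ∀ i, ∀ᵐ ω ∂P, ∀ j, |p (V i ω) j| ≤ Cp)
    (hmean : ∀ i, ∫ ω, ε i ω • p (V i ω) ∂P = 0) {S Q : Matrix (Fin k) (Fin k) ℝ}
    (hS : ∀ i, scoreCov P p (V i) (ε i) = S) (hSinv : IsUnit S.det) (hQinv : IsUnit Q.det)
    {s : ℝ} (hs : ∀ μ, Module.End.HasEigenvalue (Matrix.toLin' S⁻¹) μ → μ ≤ s)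
    {δ t η : ℝ} (hδ : 0 < δ) (ht : 0 < t) (hη : 0 < η) :
    (sandwich Q S).PosDef ∧
    ∃ N : Ω × unitInterval → Vec k, HasLaw N (stdGaussian (Vec k)) (P.prod volume) ∧
      (P.prod volume) {ω | 3 * δ + η ≤ ‖(√(n : ℝ))⁻¹ • mulVecE (invRootM (sandwich Q S) * Q⁻¹)
        (∑ i, ε i ω.1 • p (V i ω.1)) - N ω‖} ≤
        ENNReal.ofReal (2 / t + yurinskiiConst *
          (t * (k * n * (C₃ * ((√(n : ℝ))⁻¹ * (√s * (√k * Cp))) ^ 3)) / δ ^ 3) + η) := by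
  set T := invRootM (sandwich Q S) * Q⁻¹ with hT
  have hn' : (0 : ℝ) < n := by exact_mod_cast hn
  have hpV : ∀ i, Measurable fun ω => p (V i ω) := fun i => hp.comp (hVm i)
  have hpVj : ∀ i j, Measurable fun ω => p (V i ω) j := fun i j => by
    have := hpV i
    fun_prop
  have hnorm : ∀ i, ∀ᵐ ω ∂P, ‖p (V i ω)‖ ≤ √k * Cp := fun i => by
    filter_upwards [hCp i] with ω hω using norm_le_of_forall_abs_le hCp0 hω
  have hε3' : ∀ i, Integrable (fun ω => |ε i ω| ^ 3) P := fun i =>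
    (hε3 i).integrable_norm_pow (by norm_num)
  have hε2 : ∀ i, Integrable (fun ω => ε i ω ^ 2) P := fun i => by
    have := integrable_norm_pow_of_le_three (hεm i) (hε3' i) (show 2 ≤ 3 by norm_num)
    simpa using this
  have hε1 : ∀ i, Integrable (fun ω => ε i ω) P := fun i =>
    (hε3 i).integrable (by norm_num)
  have hint : ∀ i j l, Integrable (fun ω => ε i ω ^ 2 * p (V i ω) j * p (V i ω) l) P := by
    intro i j l
    refine ((hε2 i).mul_const (Cp ^ 2)).mono' (by fun_prop) ?_
    filter_upwards [hCp i] with ω hω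
    rw [mul_assoc, norm_mul, norm_mul, Real.norm_eq_abs, abs_of_nonneg (sq_nonneg (ε i ω)), sq Cp]
    exact mul_le_mul_of_nonneg_left (mul_le_mul (hω j) (hω l) (norm_nonneg _) hCp0) (sq_nonneg _)
  have hscore : ∀ i, Integrable (fun ω => ε i ω • p (V i ω)) P := by
    intro i
    refine ((hε1 i).norm.mul_const (√k * Cp)).mono'
      ((hεm i).smul (hpV i)).aestronglyMeasurable ?_
    filter_upwards [hnorm i] with ω hω
    rw [norm_smul]
    exact mul_le_mul_of_nonneg_left hω (norm_nonneg _)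
  have hSpsd : S.PosSemidef := hS ⟨0, hn⟩ ▸ scoreCov_posSemidef (hint ⟨0, hn⟩)
  have hTS := whitening_mul_mul_transpose hSpsd hSinv hQinv
  rw [← hT] at hTS
  have hTT := transpose_whitening_mul hTS
  have hTp : ∀ x : Vec k, ‖mulVecE T x‖ ≤ √s * ‖x‖ := by
    intro x
    have h1 : ‖mulVecE T x‖ ^ 2 ≤ s * ‖x‖ ^ 2 := by
      rw [norm_mulVecE_sq, hTT, ← real_inner_self_eq_norm_sq, inner_eq_dotProduct]
      exact dotProduct_mulVec_le_of_eigenvalue_le hSpsd.inv.isHermitian hs _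
    have h2 := Real.abs_le_sqrt h1
    rwa [abs_of_nonneg (norm_nonneg _), Real.sqrt_mul' _ (sq_nonneg _),
      Real.sqrt_sq (norm_nonneg _)] at h2
  refine ⟨sandwich_posDef hSpsd hSinv hQinv, ?_⟩
  let ψ : X × ℝ → Vec k := fun q => (√(n : ℝ))⁻¹ • mulVecE T (q.2 • p q.1)
  have hψm : Measurable ψ := by
    simp only [ψ, mulVecE_eq_toEuclideanCLM]
    fun_prop
  let ξ : Fin n → Ω → Vec k := fun i ω => ψ (V i ω, ε i ω)
  have hξ : ∀ i, Measurable (ξ i) := fun i => hψm.comp ((hVm i).prodMk (hεm i))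
  have hξindep : iIndepFun ξ P := hindep.comp (fun _ => ψ) fun _ => hψm
  have hξsum : ∀ ω, ∑ i, ξ i ω = (√(n : ℝ))⁻¹ • mulVecE T (∑ i, ε i ω • p (V i ω)) := fun ω => by
    simp only [ξ, ψ, mulVecE_eq_toEuclideanCLM, map_sum, Finset.smul_sum]
  have hξnorm : ∀ i, ∀ᵐ ω ∂P,
      ‖ξ i ω‖ ^ 3 ≤ |ε i ω| ^ 3 * ((√(n : ℝ))⁻¹ * (√s * (√k * Cp))) ^ 3 := by
    intro i
    filter_upwards [hnorm i] with ω hω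
    rw [← mul_pow]
    refine pow_le_pow_left₀ (norm_nonneg _) ?_ 3
    simp only [ξ, ψ, norm_smul, norm_inv, Real.norm_eq_abs, abs_of_nonneg (Real.sqrt_nonneg _)]
    calc (√(n : ℝ))⁻¹ * ‖mulVecE T (ε i ω • p (V i ω))‖
        ≤ (√(n : ℝ))⁻¹ * (√s * (|ε i ω| * (√k * Cp))) := by
          gcongr
          refine (hTp _).trans ?_
          rw [norm_smul, Real.norm_eq_abs]
          gcongr
      _ = |ε i ω| * ((√(n : ℝ))⁻¹ * (√s * (√k * Cp))) := by ring
  have hξ3 : ∀ i, Integrable (fun ω => ‖ξ i ω‖ ^ 3) P := fun i => by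
    refine ((hε3' i).mul_const (((√(n : ℝ))⁻¹ * (√s * (√k * Cp))) ^ 3)).mono'
      ((hξ i).norm.pow_const 3).aestronglyMeasurable ?_
    filter_upwards [hξnorm i] with ω hω
    rwa [norm_pow, norm_norm]
  have hinner : ∀ i u ω, inner ℝ u (ξ i ω) =
      (√(n : ℝ))⁻¹ * (ε i ω * inner ℝ (vecMulE u T) (p (V i ω))) := fun i u ω => by
    simp only [ξ, ψ]
    rw [real_inner_smul_right, inner_mulVecE, real_inner_smul_right]
  obtain ⟨N, hN, hbound⟩ := exists_yurinskii_coupling hk hn hξ hξindep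
    (b := C₃ * ((√(n : ℝ))⁻¹ * (√s * (√k * Cp))) ^ 3) hξ3
    (fun i u => by
      simp only [hinner]
      rw [integral_const_mul]
      have h1 : ∀ ω, ε i ω * inner ℝ (vecMulE u T) (p (V i ω)) =
          inner ℝ (vecMulE u T) (ε i ω • p (V i ω)) := fun ω => by rw [real_inner_smul_right]
      simp only [h1]
      rw [integral_inner (hscore i), hmean, inner_zero_right, mul_zero])
    (fun i u => by
      simp only [hinner, mul_pow]
      rw [integral_const_mul, ← dotProduct_scoreCov_mulVec (hint i), hS, inner_vecMulE_vecMulE, hTS,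
        Matrix.one_mulVec, ← inner_eq_dotProduct, real_inner_self_eq_norm_sq, inv_pow,
        Real.sq_sqrt hn'.le])
    (fun i => by
      refine (integral_mono_ae (hξ3 i) ((hε3' i).mul_const _) (hξnorm i)).trans ?_
      rw [integral_mul_const]
      exact mul_le_mul_of_nonneg_right (hC₃ i) (by positivity))
    hδ ht hη
  refine ⟨N, hN, ?_⟩
  simpa only [hξsum] using hbound

/-! ### Stochastic orders -/

lemma LittleOP.mono {Ω : ℕ → Type*} [∀ n, MeasurableSpace (Ω n)] {P : ∀ n, Measure (Ω n)}
    {X Y : ∀ n, Ω n → ℝ≥0∞} {r : ℕ → ℝ} (hY : LittleOP P Y r)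
    (h : ∀ᶠ n in atTop, ∀ᵐ ω ∂(P n), X n ω ≤ Y n ω) : LittleOP P X r := by
  intro δ hδ
  refine tendsto_of_tendsto_of_tendsto_of_le_of_le' tendsto_const_nhds (hY δ hδ)
    (Eventually.of_forall fun _ => zero_le) ?_
  filter_upwards [h] with n hn
  refine measure_mono_ae ?_
  filter_upwards [hn] with ω hω hlt
  exact lt_of_lt_of_le hlt hω

lemma LittleOP.add {Ω : ℕ → Type*} [∀ n, MeasurableSpace (Ω n)] {P : ∀ n, Measure (Ω n)}
    {X Y : ∀ n, Ω n → ℝ≥0∞} {r : ℕ → ℝ} (hX : LittleOP P X r) (hY : LittleOP P Y r) :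
    LittleOP P (fun n ω => X n ω + Y n ω) r := by
  intro δ hδ
  have h := (hX (δ / 2) (by positivity)).add (hY (δ / 2) (by positivity))
  rw [add_zero] at h
  refine tendsto_of_tendsto_of_tendsto_of_le_of_le tendsto_const_nhds h
    (fun _ => zero_le) fun n => ?_
  refine (measure_mono fun ω hω => ?_).trans (measure_union_le _ _)
  by_contra hcon
  simp only [Set.mem_union, Set.mem_ofPred_eq, not_or, not_lt] at hcon
  have h2 : ENNReal.ofReal (δ / 2 * |r n|) + ENNReal.ofReal (δ / 2 * |r n|) =
      ENNReal.ofReal (δ * |r n|) := by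
    rw [← ENNReal.ofReal_add (by positivity) (by positivity)]
    congr 1; ring
  have h3 := add_le_add hcon.1 hcon.2
  rw [h2] at h3
  exact absurd hω (not_lt.2 h3)

lemma LittleOP.comp_fst {Ω : ℕ → Type*} [∀ n, MeasurableSpace (Ω n)] {P : ∀ n, Measure (Ω n)}
    [∀ n, SFinite (P n)] {Ω' : Type*} [MeasurableSpace Ω'] {P' : Measure Ω'}
    [IsProbabilityMeasure P'] {X : ∀ n, Ω n → ℝ≥0∞} {r : ℕ → ℝ} (hX : LittleOP P X r) :
    LittleOP (fun n => (P n).prod P') (fun n ω => X n ω.1) r := by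
  intro δ hδ
  convert hX δ hδ using 2 with n
  have : {ω : Ω n × Ω' | ENNReal.ofReal (δ * |r n|) < X n ω.1} =
      {ω | ENNReal.ofReal (δ * |r n|) < X n ω} ×ˢ Set.univ := by
    ext ω; simp
  rw [this, Measure.prod_prod, measure_univ, mul_one]

lemma LittleO.littleOP {Ω : ℕ → Type*} [∀ n, MeasurableSpace (Ω n)] (P : ∀ n, Measure (Ω n))
    {x : ℕ → ℝ≥0∞} {r : ℕ → ℝ} (hx : LittleO x r) : LittleOP P (fun n _ => x n) r := by
  intro δ hδ
  refine tendsto_const_nhds.congr' ?_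
  filter_upwards [hx δ hδ] with n hn
  simp [not_lt.2 hn]

/-! ### Growth rates -/

/-- The error of Yurinskii's coupling vanishes under the growth condition: up to a constant, its
square is bounded by the absolute value of the sequence in that condition. -/
lemma tendsto_yurinskii_rate {a s : ℕ → ℝ} {K : ℕ → ℕ}
    (h : Tendsto (fun n : ℕ => a n ^ 6 * s n ^ 3 * (K n : ℝ) ^ 5 / (n : ℝ)) atTop (𝓝 0))
    (C₃ Cp : ℝ) :
    Tendsto (fun n : ℕ => a n ^ 3 * (K n * n *
      (C₃ * ((√(n : ℝ))⁻¹ * (√(s n) * (√(K n : ℝ) * Cp))) ^ 3))) atTop (𝓝 0) := by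
  have hD : Tendsto (fun n : ℕ => a n ^ 3 * (K n * n *
      ((√(n : ℝ))⁻¹ * (√(s n) * √(K n : ℝ))) ^ 3)) atTop (𝓝 0) := by
    have h1 : Tendsto (fun n : ℕ => √|a n ^ 6 * s n ^ 3 * (K n : ℝ) ^ 5 / (n : ℝ)|)
        atTop (𝓝 0) := by
      simpa using h.abs.sqrt
    refine squeeze_zero_norm (fun n => ?_) h1
    rw [Real.norm_eq_abs]
    refine Real.abs_le_sqrt ?_
    rcases Nat.eq_zero_or_pos n with rfl | hn
    · simp
    have hn' : (0 : ℝ) < n := by exact_mod_cast hn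
    have e1 : (√(n : ℝ))⁻¹ ^ 2 = (n : ℝ)⁻¹ := by rw [inv_pow, Real.sq_sqrt hn'.le]
    have e2 : √(K n : ℝ) ^ 2 = K n := Real.sq_sqrt (by positivity)
    have e3 : √(s n) ^ 2 ≤ |s n| := by
      rcases le_total 0 (s n) with hs | hs
      · rw [Real.sq_sqrt hs, abs_of_nonneg hs]
      · rw [Real.sqrt_eq_zero_of_nonpos hs]
        simp
    calc (a n ^ 3 * (K n * n * ((√(n : ℝ))⁻¹ * (√(s n) * √(K n : ℝ))) ^ 3)) ^ 2
        = a n ^ 6 * K n ^ 2 * n ^ 2 * ((√(n : ℝ))⁻¹ ^ 2) ^ 3 * (√(s n) ^ 2) ^ 3 *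
            (√(K n : ℝ) ^ 2) ^ 3 := by ring
      _ = a n ^ 6 * (K n : ℝ) ^ 5 / n * (√(s n) ^ 2) ^ 3 := by
          rw [e1, e2]; field_simp
      _ ≤ a n ^ 6 * (K n : ℝ) ^ 5 / n * |s n| ^ 3 := by
          have : 0 ≤ a n ^ 6 := by positivity
          gcongr
      _ = |a n ^ 6 * s n ^ 3 * (K n : ℝ) ^ 5 / (n : ℝ)| := by
          have : |a n ^ 6| = a n ^ 6 := abs_of_nonneg (by positivity)
          rw [abs_div, abs_mul, abs_mul, this, abs_pow (s n), abs_of_nonneg hn'.le,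
            abs_of_nonneg (a := (K n : ℝ) ^ 5) (by positivity)]
          ring
  have := hD.const_mul (C₃ * Cp ^ 3)
  rw [mul_zero] at this
  refine this.congr fun n => ?_
  ring

/-- A null sequence is dominated by the eighth power of a positive null sequence. -/
lemma exists_pos_null_pow_eight {B : ℕ → ℝ} (hB : Tendsto B atTop (𝓝 0)) :
    ∃ w : ℕ → ℝ, (∀ n, 0 < w n) ∧ Tendsto w atTop (𝓝 0) ∧ ∀ n, B n ≤ w n ^ 8 := by
  have hβ0 : ∀ n : ℕ, 0 < |B n| + 1 / ((n : ℝ) + 1) := fun n => by positivity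
  refine ⟨fun n => √√√(|B n| + 1 / ((n : ℝ) + 1)), fun n => ?_, ?_, fun n => ?_⟩
  · exact Real.sqrt_pos.2 (Real.sqrt_pos.2 (Real.sqrt_pos.2 (hβ0 n)))
  · have h1 := (hB.abs.add tendsto_one_div_add_atTop_nhds_zero_nat).sqrt.sqrt.sqrt
    simpa using h1
  · rw [show ∀ x : ℝ, x ^ 8 = ((x ^ 2) ^ 2) ^ 2 from fun x => by ring,
      Real.sq_sqrt (Real.sqrt_nonneg _), Real.sq_sqrt (Real.sqrt_nonneg _), Real.sq_sqrt (hβ0 n).le]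
    have : 0 ≤ 1 / ((n : ℝ) + 1) := by positivity
    linarith [le_abs_self (B n)]

/-- The studentized error of the series estimator at one point. Where `‖g‖ = 0` the quotients
are zero. -/
lemma enorm_studentized_sub_le {k : ℕ} {W : Matrix (Fin k) (Fin k) ℝ} (hW : W.PosDef)
    (p N bhat β : Vec k) (c A : ℝ) :
    ‖c * (inner ℝ p bhat - (inner ℝ p β + A)) / ‖vecMulE p (rootM W)‖ -
      inner ℝ (vecMulE p (rootM W)) N / ‖vecMulE p (rootM W)‖‖ₑ ≤
    ‖mulVecE (invRootM W) (c • (bhat - β)) - N‖ₑ + ‖c * |A| / ‖vecMulE p (rootM W)‖‖ₑ := by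
  set g := vecMulE p (rootM W) with hg
  set y := mulVecE (invRootM W) (c • (bhat - β)) with hy
  have h1 : inner ℝ g y = c * (inner ℝ p bhat - inner ℝ p β) := by
    rw [hg, hy, inner_vecMulE_rootM_mulVecE_invRootM hW, real_inner_smul_right, inner_sub_right]
  have h2 : c * (inner ℝ p bhat - (inner ℝ p β + A)) / ‖g‖ - inner ℝ g N / ‖g‖ =
      inner ℝ g (y - N) / ‖g‖ - c * A / ‖g‖ := by
    rw [inner_sub_right, h1]; ring
  rw [h2]
  refine (enorm_sub_le).trans (add_le_add ?_ (le_of_eq ?_))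
  · rw [← ofReal_norm, ← ofReal_norm]
    refine ENNReal.ofReal_le_ofReal ?_
    rw [norm_div, norm_norm]
    rcases eq_or_ne ‖g‖ 0 with h0 | h0
    · rw [h0, div_zero]
      exact norm_nonneg _
    · rw [div_le_iff₀ (lt_of_le_of_ne (norm_nonneg g) h0.symm), mul_comm]
      exact norm_inner_le_norm _ _
  · rw [← ofReal_norm, ← ofReal_norm, norm_div, norm_div, norm_mul, norm_mul,
      Real.norm_eq_abs |A|, abs_abs, Real.norm_eq_abs A]

end SeriesApprox

theorem mainTheorem2
    -- probability spaces `(Ω_n, P_n)`, the space of the covariate, and the set `𝒱`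
    {Ω : ℕ → Type*} [∀ n, MeasurableSpace (Ω n)]
    (P : ∀ n, Measure (Ω n)) [∀ n, IsProbabilityMeasure (P n)]
    {X : Type*} [MeasurableSpace X] (𝒱 : Set X)
    -- `a_n → ∞` and `K → ∞`
    (a : ℕ → ℝ) (ha : Tendsto a atTop atTop)
    (K : ℕ → ℕ) (hK : Tendsto K atTop atTop)
    -- the function, the basis functions, and the series estimator `p_n(v)' β̂`
    (θ : ℕ → X → ℝ)
    (p : ∀ n, X → SeriesApprox.Vec (K n)) (hp : ∀ n, Measurable (p n))
    (βhat : ∀ n, Ω n → SeriesApprox.Vec (K n))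
    (θhat : ∀ n, Ω n → X → ℝ)
    (hθhat : ∀ n ω, ∀ v ∈ 𝒱, θhat n ω v = inner ℝ (p n v) (βhat n ω))
    -- the i.i.d. sample `(V_i, ε_i)`, `i = 1, …, n`
    (V : ∀ n, Fin n → Ω n → X) (ε : ∀ n, Fin n → Ω n → ℝ)
    (hVm : ∀ n i, Measurable (V n i)) (hεm : ∀ n i, Measurable (ε n i))
    (hV𝒱 : ∀ n i, ∀ᵐ ω ∂(P n), V n i ω ∈ 𝒱)
    (hindep : ∀ n, iIndepFun (fun i ω => (V n i ω, ε n i ω)) (P n))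
    (hident : ∀ n i j, IdentDistrib (fun ω => (V n i ω, ε n i ω))
      (fun ω => (V n j ω, ε n j ω)) (P n) (P n))
    -- bounded third moments of the errors and bounded basis functions
    (hε3 : ∀ n i, MemLp (ε n i) 3 (P n))
    (hε3bdd : ∃ C : ℝ, ∀ n i, ∫ ω, |ε n i ω| ^ 3 ∂(P n) ≤ C)
    (hpbdd : ∃ C : ℝ, ∀ n, ∀ v ∈ 𝒱, ∀ j, |p n v j| ≤ C)
    -- moments of the score and the matrices `S_n`, `Q_n`
    (hmean : ∀ n i, ∫ ω, ε n i ω • p n (V n i ω) ∂(P n) = 0)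
    (S Q : ∀ n, Matrix (Fin (K n)) (Fin (K n)) ℝ)
    (hS : ∀ n i, SeriesApprox.scoreCov (P n) (p n) (V n i) (ε n i) = S n)
    (hSinv : ∀ n, IsUnit (S n).det) (hQinv : ∀ n, IsUnit (Q n).det)
    (s : ℕ → ℝ)
    (hs : ∀ n μ, Module.End.HasEigenvalue (Matrix.toLin' (S n)⁻¹) μ → μ ≤ s n)
    -- the matrix `Ω_n = Q_n⁻¹ S_n (Q_n⁻¹)'`
    (W : ∀ n, Matrix (Fin (K n)) (Fin (K n)) ℝ)
    (hW : ∀ n, W n = SeriesApprox.sandwich (Q n) (S n))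
    -- the asymptotically linear representation around `β`
    (β : ∀ n, SeriesApprox.Vec (K n))
    (r : ∀ n, Ω n → SeriesApprox.Vec (K n))
    (hlin : ∀ n, ∀ᵐ ω ∂(P n),
      SeriesApprox.mulVecE (SeriesApprox.invRootM (W n)) (√(n : ℝ) • (βhat n ω - β n)) =
        (√(n : ℝ))⁻¹ • SeriesApprox.mulVecE (SeriesApprox.invRootM (W n) * (Q n)⁻¹)
          (∑ i, ε n i ω • p n (V n i ω)) + r n ω)
    (hr : SeriesApprox.LittleOP P (fun n ω => ‖r n ω‖ₑ) (fun n => (a n)⁻¹))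
    -- the approximation error `A_n` and the vector `g_n(v)' = p_n(v)' Ω_n^{1/2}`
    (g : ∀ n, X → SeriesApprox.Vec (K n))
    (hg : ∀ n v, g n v = SeriesApprox.vecMulE (p n v) (SeriesApprox.rootM (W n)))
    (A : ℕ → X → ℝ)
    (hA : ∀ n, ∀ v ∈ 𝒱, θ n v = inner ℝ (p n v) (β n) + A n v)
    (hAsmall : SeriesApprox.LittleO
      (fun n => SeriesApprox.supOn 𝒱 fun v => √(n : ℝ) * |A n v| / ‖g n v‖) (fun n => (a n)⁻¹))
    -- the growth condition
    (hgrowth : Tendsto (fun n : ℕ => a n ^ 6 * s n ^ 3 * (K n : ℝ) ^ 5 / (n : ℝ)) atTop (𝓝 0)) :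
    -- on each probability space enlarged by an independent uniform variable
    ∃ N : ∀ n, Ω n × unitInterval → SeriesApprox.Vec (K n),
      (∀ n, HasLaw (N n) (stdGaussian (SeriesApprox.Vec (K n))) ((P n).prod volume)) ∧
      SeriesApprox.LittleOP (fun n => (P n).prod (volume : Measure unitInterval))
        (fun n ω => ‖SeriesApprox.mulVecE (SeriesApprox.invRootM (W n))
          (√(n : ℝ) • (βhat n ω.1 - β n)) - N n ω‖ₑ)
        (fun n => (a n)⁻¹) ∧
      SeriesApprox.LittleOP (fun n => (P n).prod (volume : Measure unitInterval))
        (fun n ω => SeriesApprox.supOn 𝒱 fun v =>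
          √(n : ℝ) * (θhat n ω.1 v - θ n v) / ‖g n v‖ - inner ℝ (g n v) (N n ω) / ‖g n v‖)
        (fun n => (a n)⁻¹) := by
  obtain ⟨C₃, hC₃⟩ := hε3bdd
  obtain ⟨Cp', hCp'⟩ := hpbdd
  set Cp : ℝ := max Cp' 0 with hCpdef
  have hCp : ∀ n i, ∀ᵐ ω ∂(P n), ∀ j, |p n (V n i ω) j| ≤ Cp := fun n i => by
    filter_upwards [hV𝒱 n i] with ω hω j using (hCp' n _ hω j).trans (le_max_left _ _)
  obtain ⟨w, hw0, hw, hBw⟩ :=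
    SeriesApprox.exists_pos_null_pow_eight (SeriesApprox.tendsto_yurinskii_rate hgrowth C₃ Cp)
  have hY0 : 0 ≤ SeriesApprox.yurinskiiConst := by
    have := SeriesApprox.gaussFourth_nonneg
    unfold SeriesApprox.yurinskiiConst
    linarith
  -- The coupling at each `n`, at scale `w / a` and with truncation level `1 / w`.
  have hcoupling : ∀ n, ∃ N : Ω n × unitInterval → SeriesApprox.Vec (K n),
      HasLaw N (stdGaussian (SeriesApprox.Vec (K n))) ((P n).prod volume) ∧
      (0 < n → 0 < K n → 0 < a n → (W n).PosDef ∧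
        ((P n).prod volume) {ω | 4 * w n / a n ≤ ‖(√(n : ℝ))⁻¹ •
          SeriesApprox.mulVecE (SeriesApprox.invRootM (W n) * (Q n)⁻¹)
            (∑ i, ε n i ω.1 • p n (V n i ω.1)) - N ω‖} ≤
          ENNReal.ofReal (3 * w n + SeriesApprox.yurinskiiConst * w n ^ 4)) := by
    intro n
    by_cases hn : 0 < n ∧ 0 < K n ∧ 0 < a n
    · obtain ⟨hn0, hK0, ha0⟩ := hn
      have hwn := hw0 n
      have hη : 0 < min (w n) (w n / a n) := lt_min hwn (by positivity)
      obtain ⟨hpd, N, hN, hb⟩ := SeriesApprox.exists_score_coupling hK0 hn0 (hp n) (hVm n) (hεm n)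
        (hindep n) (hε3 n) (hC₃ n) (le_max_right _ _) (hCp n) (hmean n) (hS n) (hSinv n) (hQinv n)
        (hs n) (δ := w n / a n) (t := 1 / w n) (by positivity) (by positivity) hη
      rw [← hW] at hpd hb
      refine ⟨N, hN, fun _ _ _ => ⟨hpd, ?_⟩⟩
      refine (measure_mono fun ω hω => ?_).trans (hb.trans (ENNReal.ofReal_le_ofReal ?_))
      · refine le_trans ?_ (show 4 * w n / a n ≤ _ from hω)
        have h1 := min_le_right (w n) (w n / a n)
        have h2 : 4 * w n / a n = 3 * (w n / a n) + w n / a n := by ring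
        linarith
      · have h1 := min_le_left (w n) (w n / a n)
        have h2 : 2 / (1 / w n) = 2 * w n := by field_simp
        set b := C₃ * ((√(n : ℝ))⁻¹ * (√(s n) * (√(K n : ℝ) * Cp))) ^ 3 with hbdef
        have h3 : 1 / w n * (K n * n * b) / (w n / a n) ^ 3 =
            a n ^ 3 * (K n * n * b) / w n ^ 4 := by
          field_simp
        have h4 : a n ^ 3 * (K n * n * b) / w n ^ 4 ≤ w n ^ 4 := by
          rw [div_le_iff₀ (by positivity), ← pow_add]
          exact hBw n
        have h5 := mul_le_mul_of_nonneg_left h4 hY0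
        rw [h2, h3]
        linarith
    · obtain ⟨f, hf, hflaw⟩ :=
        Measure.exists_measurable_map_eq (stdGaussian (SeriesApprox.Vec (K n)))
      refine ⟨fun ω => f ω.2, ⟨(hf.comp measurable_snd).aemeasurable, ?_⟩,
        fun h1 h2 h3 => absurd ⟨h1, h2, h3⟩ hn⟩
      have : (fun ω : Ω n × unitInterval => f ω.2) = f ∘ Prod.snd := rfl
      rw [this, ← Measure.map_map hf measurable_snd, Measure.map_snd_prod]
      simpa using hflaw
  choose N hN hNb using hcoupling
  have hev : ∀ᶠ n in atTop, 0 < n ∧ 0 < K n ∧ 0 < a n :=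
    (eventually_gt_atTop 0).and ((hK.eventually_gt_atTop 0).and (ha.eventually_gt_atTop 0))
  -- The standardized score is within `o_p(1 / a)` of `N`.
  have hscore : SeriesApprox.LittleOP (fun n => (P n).prod (volume : Measure unitInterval))
      (fun n ω => ‖(√(n : ℝ))⁻¹ • SeriesApprox.mulVecE (SeriesApprox.invRootM (W n) * (Q n)⁻¹)
        (∑ i, ε n i ω.1 • p n (V n i ω.1)) - N n ω‖ₑ) (fun n => (a n)⁻¹) := by
    intro δ hδ
    have hlim : Tendsto (fun n => ENNReal.ofReal
        (3 * w n + SeriesApprox.yurinskiiConst * w n ^ 4)) atTop (𝓝 0) := by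
      have h1 := (hw.const_mul 3).add ((hw.pow 4).const_mul SeriesApprox.yurinskiiConst)
      have h2 := ENNReal.tendsto_ofReal h1
      simpa using h2
    refine tendsto_of_tendsto_of_tendsto_of_le_of_le' tendsto_const_nhds hlim
      (Eventually.of_forall fun _ => zero_le) ?_
    filter_upwards [hev, hw.eventually_le_const (show (0 : ℝ) < δ / 4 by positivity)]
      with n ⟨hn0, hK0, ha0⟩ hwn
    refine (measure_mono fun ω hω => ?_).trans (hNb n hn0 hK0 ha0).2
    have h1 : ENNReal.ofReal (δ * |(a n)⁻¹|) < _ := hω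
    rw [← ofReal_norm] at h1
    have h2 := (ENNReal.ofReal_lt_ofReal_iff_of_nonneg (by positivity)).1 h1
    rw [abs_of_pos (inv_pos.2 ha0), ← div_eq_mul_inv] at h2
    refine le_trans ?_ h2.le
    gcongr
    linarith
  have hmain : SeriesApprox.LittleOP (fun n => (P n).prod (volume : Measure unitInterval))
      (fun n ω => ‖SeriesApprox.mulVecE (SeriesApprox.invRootM (W n))
        (√(n : ℝ) • (βhat n ω.1 - β n)) - N n ω‖ₑ) (fun n => (a n)⁻¹) := by
    refine (hscore.add hr.comp_fst).mono (Eventually.of_forall fun n => ?_)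
    have hae : ∀ᵐ ω ∂((P n).prod (volume : Measure unitInterval)), _ :=
      Measure.quasiMeasurePreserving_fst.ae (hlin n)
    filter_upwards [hae] with ω hω
    rw [hω, add_sub_right_comm]
    exact enorm_add_le _ _
  refine ⟨N, hN, hmain, ?_⟩
  refine (hmain.add (hAsmall.littleOP _)).mono ?_
  filter_upwards [hev] with n ⟨hn0, hK0, ha0⟩
  refine ae_of_all _ fun ω => ?_
  refine iSup₂_le fun v hv => ?_
  have hpt := SeriesApprox.enorm_studentized_sub_le (hNb n hn0 hK0 ha0).1 (p n v) (N n ω)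
    (βhat n ω.1) (β n) √(n : ℝ) (A n v)
  rw [← hg, ← hθhat n ω.1 v hv, ← hA n v hv] at hpt
  refine hpt.trans (add_le_add_right ?_ _)
  exact le_iSup₂ (f := fun v (_ : v ∈ 𝒱) => ‖√(n : ℝ) * |A n v| / ‖g n v‖‖ₑ) v hv
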